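/- Let $d\ge 0$, let $(\Omega,\mathcal F,\mathbb P)$ be a probability space with a jointly measurable flow $(\theta_t)_{t\in\mathbb R^d}$ that leaves $\mathbb P$ invariant. Let $\mathbf N$ be the space of locally finite counting measures on $\mathbb R^d$ (not necessarily simple) with the Borel $\sigma$-field of the vague topology, and let $\mathbf N^0\subset\mathbf N$ be the subspace of those $\phi$ with $\phi(\{0\})>0$. For $\phi\in\mathbf N$ put $(\theta_t\phi)(B)=\phi(B+t)$, and write $x\in\phi$ if $\phi(\{x\})>0$. Let $\Phi:\Omega\to\mathbf N$ be measurable and compatible, $\Phi\circ\theta_t=\theta_t\circ\Phi$ for all $t$, with intensity $\lambda=\mathbb E[\Phi([0,1)^d)]\in(0,\infty)$. For a random measure $\xi$ on $\mathbb R^d$ compatible with the flow, with intensity $\lambda_\xi\in(0,\infty)$, its Palm probability on $\Omega$ is $$\mathbb P^0_\xi[F]=\frac1{\lambda_\xi|B|}\int_\Omega\int_B \mathbf 1\{\theta_t\omega\in F\}\,\xi(\omega,dt)\,\mathbb P(d\omega),\qquad F\in\mathcal F,$$ where $B$ is any Borel set with $0<|B|<\infty$. Let $\mathcal P_0=\Phi_*\mathbb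 P^0_\Phi$, a probability measure on $\mathbf N^0$. Let $g$ be a point-map, i.e. a measurable map $g:\mathbf N^0\to\mathbb R^d$ with $g(\phi)\in\phi$ which depends on $\phi$ only through its support. Let $f_\phi(x)=x+g(\theta_x\phi)$, $x\in\phi$, be the associated point-shift, $\theta_g:\mathbf N^0\to\mathbf N^0$, $\theta_g(\phi)=\theta_{g(\phi)}\phi$, and let $f^n_\phi\phi$ be the image of the measure $\phi$ under the $n$-th iterate $f_\phi^n$ of $f_\phi$. Assume that $f$ is $1$-periodic on $(\Phi,\mathbb P)$: for $\Phi_*\mathbb P$-almost every $\phi$ and every $x\in\phi$, the sequence $(f^n_\phi(x))_n$ is eventually constant. Denote its eventual value by $f^\infty_\phi(x)$ and let $f^\infty_\phi\phi$ be the image of the measure $\phi$ under $f^\infty_\phi$. Then almost surely $f^\infty_\Phi\Phi$ is a locally finite counting measure and, for every bounded Borel set $A$, $f^n_\Phi\Phi(A)=f^\infty_\Phi\Phi(A)$ for all large $n$; its intensity is $\lambda$. The probability measures $(\theta_g^{\,n})_*\mathcal P_0$ on $\mathbf N^0$ converge weakly as $n\to\infty$ to a probability measure $\mathcal P_0^g$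 (the $g$ probability of $\mathcal P_0$ exists), and $$\mathcal P^g_0=\Phi_*\,\mathbb P^0_{f^\infty_\Phi\Phi}.$$ Moreover $\mathcal P^g_0$ is absolutely continuous with respect to $\mathcal P_0$, with $$\frac{d\mathcal P^g_0}{d\mathcal P_0}(\phi)=\frac{(f^\infty_\phi\phi)(\{0\})}{\phi(\{0\})}\quad\text{for }\mathcal P_0\text{-almost every }\phi,$$ and $(\theta_g)_*\mathcal P^g_0=\mathcal P^g_0$. -/

import Mathlib

open MeasureTheory Set Filter Topology
open scoped ENNReal

noncomputable section

/-- A locally finite counting measure on `ℝ^d` (not necessarily simple): a Borel measure which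
takes a finite natural-number value on every bounded Borel set. -/
structure CountingMeasure (d : ℕ) where
  toMeasure : Measure (EuclideanSpace ℝ (Fin d))
  exists_nat' : ∀ B : Set (EuclideanSpace ℝ (Fin d)), MeasurableSet B → Bornology.IsBounded B →
    ∃ n : ℕ, toMeasure B = n

namespace CountingMeasure

variable {d : ℕ}

/-- The vague topology: the coarsest topology for which `φ ↦ ∫ h dφ` is continuous for every
continuous compactly supported `h`. -/
instance : TopologicalSpace (CountingMeasure d) :=
  TopologicalSpace.induced
    (fun (φ : CountingMeasure d) (h : CompactlySupportedContinuousMap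
      (EuclideanSpace ℝ (Fin d)) ℝ) => ∫ x, h x ∂φ.toMeasure)
    inferInstance

/-- The Borel `σ`-field of the vague topology. -/
instance : MeasurableSpace (CountingMeasure d) := borel _

instance : BorelSpace (CountingMeasure d) := ⟨rfl⟩

/-- `x` is a point of `φ`, that is, `x` belongs to the multiset associated with `φ`. -/
def HasPoint (φ : CountingMeasure d) (x : EuclideanSpace ℝ (Fin d)) : Prop :=
  φ.toMeasure {x} ≠ 0

/-- The translate `θ_t φ = φ - t`, so that `(θ_t φ)(B - t) = φ(B)`. -/
def shift (t : EuclideanSpace ℝ (Fin d)) (φ : CountingMeasure d) : CountingMeasure d where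
  toMeasure := φ.toMeasure.map (fun x => x - t)
  exists_nat' := by
    intro B hB hb
    have hm : Measurable (fun x : EuclideanSpace ℝ (Fin d) => x - t) := by fun_prop
    rw [Measure.map_apply hm hB]
    refine φ.exists_nat' _ (hm hB) ?_
    have h1 : (fun x : EuclideanSpace ℝ (Fin d) => x - t) ⁻¹' B ⊆ (fun x => x + t) '' B :=
      fun x hx => ⟨x - t, hx, by simp⟩
    exact ((LipschitzWith.id.add (LipschitzWith.const t)).isBounded_image hb).subset h1

theorem shift_hasPoint {t : EuclideanSpace ℝ (Fin d)} {φ : CountingMeasure d}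
    {x : EuclideanSpace ℝ (Fin d)} : (φ.shift t).HasPoint x ↔ φ.HasPoint (x + t) := by
  have hm : Measurable (fun x : EuclideanSpace ℝ (Fin d) => x - t) := by fun_prop
  have : (fun y : EuclideanSpace ℝ (Fin d) => y - t) ⁻¹' {x} = {x + t} := by
    ext y; simp [sub_eq_iff_eq_add]
  simp only [HasPoint, shift, Measure.map_apply hm (measurableSet_singleton x), this]

end CountingMeasure

/-- The space of counting measures with a point at the origin, with the induced topology and the
induced `σ`-field. -/
abbrev CountingMeasure₀ (d : ℕ) : Type := {φ : CountingMeasure d // φ.HasPoint 0}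

/-- A point-map: a measurable map which assigns to each counting measure `φ` with a point at the
origin a point of `φ`, and which depends on `φ` only through its support (that is, which extends
a simple point-map by forgetting multiplicities). -/
structure PointMap (d : ℕ) where
  toFun : CountingMeasure₀ d → EuclideanSpace ℝ (Fin d)
  measurable' : Measurable toFun
  hasPoint' : ∀ φ : CountingMeasure₀ d, φ.1.HasPoint (toFun φ)
  support' : ∀ φ ψ : CountingMeasure₀ d, (∀ x, φ.1.HasPoint x ↔ ψ.1.HasPoint x) →
    toFun φ = toFun ψ

namespace PointMap

variable {d : ℕ}

/-- The map `θ_g : φ ↦ θ_{g(φ)} φ` on counting measures with a point at the origin. Its `n`-th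
iterate is `φ ↦ θ_{g^n(φ)} φ`, where `g^n` is the point-map of the `n`-th iterate of the
point-shift. -/
def translate (g : PointMap d) (φ : CountingMeasure₀ d) : CountingMeasure₀ d :=
  ⟨φ.1.shift (g.toFun φ), CountingMeasure.shift_hasPoint.2 (by simpa using g.hasPoint' φ)⟩

open Classical in
/-- The compatible point-shift `f_g(φ, x) = x + g(θ_x φ)`, for `x` a point of `φ`. (If `x` is not
a point of `φ`, the value is `x` by convention.) -/
def pointShift (g : PointMap d) (φ : CountingMeasure d) (x : EuclideanSpace ℝ (Fin d)) :
    EuclideanSpace ℝ (Fin d) :=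
  if h : φ.HasPoint x then
    x + g.toFun ⟨φ.shift x, CountingMeasure.shift_hasPoint.2 (by simpa using h)⟩
  else x

/-- The image `f_φ^n φ` of `φ` under `n` iterations of the point-shift; multiplicities add up. It
is a measure which need not be locally finite. -/
def image (g : PointMap d) (n : ℕ) (φ : CountingMeasure d) :
    Measure (EuclideanSpace ℝ (Fin d)) :=
  φ.toMeasure.map ((g.pointShift φ)^[n])

/-- `f_g` is `p`-periodic under the law `Q` on the space of counting measures: for almost every
`φ`, for every point `x` of `φ`, the orbit of `x` is eventually periodic with period `p`. -/
def IsPeriodic (g : PointMap d) (p : ℕ) (Q : Measure (CountingMeasure d)) : Prop :=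
  ∀ᵐ φ ∂Q, ∀ x, φ.HasPoint x →
    ∃ N : ℕ, ∀ n ≥ N, (g.pointShift φ)^[n] x = (g.pointShift φ)^[n + p] x

open Classical in
/-- The eventual value `f^∞(φ, x)` of the orbit of `x`, if this orbit is eventually constant.
(Otherwise, the value is `x` by convention.) -/
def limitShift (g : PointMap d) (φ : CountingMeasure d) (x : EuclideanSpace ℝ (Fin d)) :
    EuclideanSpace ℝ (Fin d) :=
  if h : ∃ N : ℕ, ∀ n ≥ N, (g.pointShift φ)^[n] x = (g.pointShift φ)^[N] x then
    (g.pointShift φ)^[Nat.find h] x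
  else x

/-- The limit image `f_φ^∞ φ`: every point of `φ` is moved, with its multiplicity, to the eventual
value of its orbit; multiplicities add up. -/
def limitImage (g : PointMap d) (φ : CountingMeasure d) :
    Measure (EuclideanSpace ℝ (Fin d)) :=
  φ.toMeasure.map (g.limitShift φ)

/-- `Q` is the `g` probability of `μ₀`: the measures `(θ_{g^n})_* μ₀` are probability measures
on the space of counting measures with a point at the origin, and they converge weakly (in
distribution) to the probability measure `Q`. -/
def IsPointMapProbability (g : PointMap d) (μ₀ Q : Measure (CountingMeasure₀ d)) : Prop :=
  ∃ (μ : ℕ → ProbabilityMeasure (CountingMeasure₀ d))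
    (ν : ProbabilityMeasure (CountingMeasure₀ d)),
    (∀ n, (μ n : Measure (CountingMeasure₀ d)) = μ₀.map (g.translate^[n])) ∧
    (ν : Measure (CountingMeasure₀ d)) = Q ∧
    Tendsto μ atTop (𝓝 ν)

end PointMap

/-- A measurable flow `(θ_t)`, `t ∈ ℝ^d`, on a measurable space. -/
structure MeasurableFlow (d : ℕ) (Ω : Type*) [MeasurableSpace Ω] where
  toFun : EuclideanSpace ℝ (Fin d) → Ω → Ω
  zero' : ∀ ω, toFun 0 ω = ω
  add' : ∀ s t ω, toFun (s + t) ω = toFun s (toFun t ω)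
  measurable' : Measurable (fun p : EuclideanSpace ℝ (Fin d) × Ω => toFun p.1 p.2)

section Palm

variable {d : ℕ} {Ω : Type*} [MeasurableSpace Ω]

/-- `(Φ, ℙ)` is a stationary point process: `Φ` is a measurable map to the space of counting
measures, `Φ` is compatible with the flow, and `ℙ` is invariant under the flow. -/
structure IsStationaryPointProcess (θ : MeasurableFlow d Ω) (P : Measure Ω)
    (Φ : Ω → CountingMeasure d) : Prop where
  measurable : Measurable Φ
  compatible : ∀ t ω, Φ (θ.toFun t ω) = (Φ ω).shift t
  invariant : ∀ t, P.map (θ.toFun t) = P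

/-- The intensity of a (stationary) random measure `ξ`: the mean mass of the unit cube. -/
def intensity (P : Measure Ω) (ξ : Ω → Measure (EuclideanSpace ℝ (Fin d))) : ℝ≥0∞ :=
  ∫⁻ ω, ξ ω {x | ∀ i, x i ∈ Ico (0 : ℝ) 1} ∂P

/-- The Palm probability on `Ω` of a stationary random measure `ξ` of intensity `λ`, computed
through the window `B`:
`F ↦ (λ |B|)⁻¹ ∫ ∫_B 1 {θ_t ω ∈ F} ξ(ω, dt) P(dω)`.
For `ξ` a counting measure, the inner integral is the sum over the points of `ξ(ω)` in `B`,
with multiplicities. -/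
def palm (θ : MeasurableFlow d Ω) (P : Measure Ω)
    (ξ : Ω → Measure (EuclideanSpace ℝ (Fin d))) (B : Set (EuclideanSpace ℝ (Fin d))) :
    Measure Ω :=
  (intensity P ξ * volume B)⁻¹ •
    P.bind (fun ω => ((ξ ω).restrict B).map (fun t => θ.toFun t ω))

theorem palm_apply (θ : MeasurableFlow d Ω) (P : Measure Ω)
    (ξ : Ω → Measure (EuclideanSpace ℝ (Fin d))) (B : Set (EuclideanSpace ℝ (Fin d)))
    (h : AEMeasurable (fun ω => ((ξ ω).restrict B).map (fun t => θ.toFun t ω)) P)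
    {F : Set Ω} (hF : MeasurableSet F) :
    palm θ P ξ B F = (intensity P ξ * volume B)⁻¹ *
      ∫⁻ ω, ∫⁻ t in B, F.indicator 1 (θ.toFun t ω) ∂(ξ ω) ∂P := by
  have hm : ∀ ω, Measurable (fun t => θ.toFun t ω) := fun ω =>
    θ.measurable'.comp (measurable_id.prodMk measurable_const)
  simp only [palm, Measure.smul_apply, smul_eq_mul]
  rw [Measure.bind_apply hF h]
  congr 1
  refine lintegral_congr fun ω => ?_
  rw [Measure.map_apply (hm ω) hF, ← lintegral_indicator_one ((hm ω) hF)]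
  rfl

/-- The law of `Φ` under the Palm probability of `ξ`, as a measure on the space of counting
measures with a point at the origin. -/
def palmLaw (θ : MeasurableFlow d Ω) (P : Measure Ω) (Φ : Ω → CountingMeasure d)
    (ξ : Ω → Measure (EuclideanSpace ℝ (Fin d))) (B : Set (EuclideanSpace ℝ (Fin d))) :
    Measure (CountingMeasure₀ d) :=
  ((palm θ P ξ B).map Φ).comap Subtype.val

end Palm

end

/-! The engine is the refined Campbell theorem `lintegral_lintegral_flow`. By stationarity, the
Campbell measure `campbell` of `Φ` is invariant under translations of the location, so uniqueness of
Haar measure factors it as Lebesgue measure times a Palm measure (`volume_prod_palmMeasure`).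

Applied to a function that moves each point to the end of its orbit, it gives the mass transport
formula `lintegral_limitShift`: because `f^∞` commutes with translations, transporting mass along it
changes no mean. Hence the limit image has mean mass `λ|A|` in `A` and is almost surely locally
finite. Only finitely many points then end at a given location, so on a bounded set only finitely
many orbits matter and the images stabilise (`eventually_image_eq_limitImage`).

The Palm probability of the limit image is computed twice. It is the image of that of `Φ` under `ω ↦
θ_{f^∞(0)} ω` (`palm_limitImage_eq_map`), by mass transport; and it has a density with respect to it
(`palm_limitImage_eq_withDensity`), because a location counted `φ{x}` times by `φ` is counted
`f^∞φ{x}` times by the limit image.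

On `N^0`, the `n`-th iterate of `θ_g` translates `φ` by `f^n(0)`, which is almost surely eventually
constant. Dominated convergence therefore gives weak convergence to the image under
`limitTranslate`, with no continuity of `g`. Invariance follows since the eventual value of an
iteration is a fixed point. -/

namespace CountingMeasure

/-! ### Atoms of counting measures and the vague Borel field. -/

variable {d : ℕ}

theorem measure_lt_top_of_isBounded (φ : CountingMeasure d) {B : Set (EuclideanSpace ℝ (Fin d))}
    (hB : Bornology.IsBounded B) : φ.toMeasure B < ⊤ := by
  obtain ⟨n, hn⟩ := φ.exists_nat' (closure B) isClosed_closure.measurableSet hB.closure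
  exact (measure_mono subset_closure).trans_lt (by simp [hn])

instance (φ : CountingMeasure d) : IsFiniteMeasureOnCompacts φ.toMeasure :=
  ⟨fun _ hK => φ.measure_lt_top_of_isBounded hK.isBounded⟩

/-- A finite value is a limit of integers along an exhaustion by balls, and the integers are closed
in `ℝ`. Needed beyond bounded sets because preimages under `f^∞` may be unbounded. -/
theorem exists_nat_of_ne_top (φ : CountingMeasure d) {B : Set (EuclideanSpace ℝ (Fin d))}
    (hB : MeasurableSet B) (h : φ.toMeasure B ≠ ⊤) : ∃ n : ℕ, φ.toMeasure B = n := by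
  have hn : ∀ n : ℕ, ∃ k : ℕ, φ.toMeasure (B ∩ Metric.closedBall 0 n) = k := fun n =>
    φ.exists_nat' _ (hB.inter Metric.isClosed_closedBall.measurableSet)
      (Metric.isBounded_closedBall.subset inter_subset_right)
  choose u hu using hn
  have hmono : Monotone fun n : ℕ => B ∩ Metric.closedBall (0 : EuclideanSpace ℝ (Fin d)) n :=
    fun m n hmn => inter_subset_inter_right _ (Metric.closedBall_subset_closedBall (by simpa))
  have hlim := tendsto_measure_iUnion_atTop (μ := φ.toMeasure) hmono
  rw [← inter_iUnion, Metric.iUnion_closedBall_nat, inter_univ] at hlim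
  have hlim' := (ENNReal.tendsto_toReal h).comp hlim
  obtain ⟨k, hk⟩ := Nat.isClosedEmbedding_coe_real.isClosed_range.mem_of_tendsto hlim'
    (Eventually.of_forall fun n => ⟨u n, by simp [hu]⟩)
  refine ⟨k, ?_⟩
  rw [← ENNReal.ofReal_toReal h, ← hk, ENNReal.ofReal_natCast]

theorem one_le_of_hasPoint {φ : CountingMeasure d} {x : EuclideanSpace ℝ (Fin d)}
    (h : φ.HasPoint x) : 1 ≤ φ.toMeasure {x} := by
  obtain ⟨n, hn⟩ := φ.exists_nat' {x} (measurableSet_singleton x) Bornology.isBounded_singleton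
  rw [HasPoint, hn] at h
  rw [hn]
  exact_mod_cast Nat.one_le_iff_ne_zero.2 (by exact_mod_cast h)

theorem finite_setOf_hasPoint_of_ne_top (φ : CountingMeasure d)
    {S : Set (EuclideanSpace ℝ (Fin d))} (hS : φ.toMeasure S ≠ ⊤) :
    {x ∈ S | φ.HasPoint x}.Finite := by
  have h := Measure.finite_const_le_meas_of_disjoint_iUnion φ.toMeasure (ε := 1) one_pos
    (As := fun x : {x ∈ S | φ.HasPoint x} => {(x : EuclideanSpace ℝ (Fin d))})
    (fun _ => measurableSet_singleton _)
    (fun x y hxy => by simpa [Function.onFun, Subtype.ext_iff] using hxy)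
    (ne_top_of_le_ne_top hS (measure_mono (iUnion_subset fun x => by simpa using x.2.1)))
  have huniv : {x : {x ∈ S | φ.HasPoint x} |
      1 ≤ φ.toMeasure {(x : EuclideanSpace ℝ (Fin d))}} = univ :=
    eq_univ_of_forall fun x => one_le_of_hasPoint x.2.2
  rw [huniv, finite_univ_iff] at h
  exact h

theorem countable_setOf_hasPoint (φ : CountingMeasure d) : {x | φ.HasPoint x}.Countable := by
  have h : {x | φ.HasPoint x} ⊆ ⋃ n : ℕ, {x ∈ Metric.closedBall 0 n | φ.HasPoint x} := by
    intro x hx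
    obtain ⟨n, hn⟩ := exists_nat_ge ‖x‖
    exact mem_iUnion.2 ⟨n, by simpa using hn, hx⟩
  exact (countable_iUnion fun n => (φ.finite_setOf_hasPoint_of_ne_top
    (φ.measure_lt_top_of_isBounded Metric.isBounded_closedBall).ne).countable).mono h

theorem measurableSet_setOf_hasPoint (φ : CountingMeasure d) :
    MeasurableSet {x | φ.HasPoint x} :=
  φ.countable_setOf_hasPoint.measurableSet

/-- Small balls around a location without an atom have mass below `1`, hence mass `0` by
integrality; locally null sets are null. So a counting measure is purely atomic. -/
theorem ae_hasPoint (φ : CountingMeasure d) : ∀ᵐ x ∂φ.toMeasure, φ.HasPoint x := by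
  refine measure_null_of_locally_null _ fun x hx => ?_
  have hx : φ.toMeasure {x} = 0 := by simpa [HasPoint] using hx
  have hanti : Antitone fun n : ℕ => Metric.closedBall x (1 / ((n : ℝ) + 1)) :=
    fun m n hmn => Metric.closedBall_subset_closedBall (Nat.one_div_le_one_div hmn)
  have hlim := tendsto_measure_iInter_atTop (μ := φ.toMeasure)
    (fun n => Metric.isClosed_closedBall.measurableSet.nullMeasurableSet) hanti
    ⟨0, (φ.measure_lt_top_of_isBounded Metric.isBounded_closedBall).ne⟩
  have hinter : ⋂ n : ℕ, Metric.closedBall x (1 / ((n : ℝ) + 1)) = {x} := by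
    ext y
    simp only [mem_iInter, Metric.mem_closedBall, mem_singleton_iff]
    refine ⟨fun h => dist_le_zero.1 (ge_of_tendsto' tendsto_one_div_add_atTop_nhds_zero_nat h),
      fun h n => ?_⟩
    rw [h, dist_self]; positivity
  rw [hinter, hx] at hlim
  obtain ⟨n, hn⟩ := (hlim.eventually_lt_const one_pos).exists
  refine ⟨_, mem_nhdsWithin_of_mem_nhds
    (Metric.closedBall_mem_nhds x (Nat.one_div_pos_of_nat (n := n))), ?_⟩
  obtain ⟨k, hk⟩ := φ.exists_nat' (Metric.closedBall x (1 / ((n : ℝ) + 1)))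
    Metric.isClosed_closedBall.measurableSet Metric.isBounded_closedBall
  rw [Function.comp_apply, hk] at hn
  rw [hk]
  have : k < 1 := by exact_mod_cast hn
  simpa using this

theorem continuous_integral (h : CompactlySupportedContinuousMap (EuclideanSpace ℝ (Fin d)) ℝ) :
    Continuous fun φ : CountingMeasure d => ∫ x, h x ∂φ.toMeasure :=
  (continuous_apply h).comp (continuous_induced_dom
    (f := fun (φ : CountingMeasure d) (h : CompactlySupportedContinuousMap
      (EuclideanSpace ℝ (Fin d)) ℝ) => ∫ x, h x ∂φ.toMeasure))

/-- The evaluations `φ ↦ φ(A)` are measurable for the Borel `σ`-field of the vague topology. -/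
theorem measurable_toMeasure :
    Measurable (toMeasure : CountingMeasure d → Measure (EuclideanSpace ℝ (Fin d))) := by
  have hclosed : ∀ C : Set (EuclideanSpace ℝ (Fin d)), IsClosed C → Bornology.IsBounded C →
      Measurable fun φ : CountingMeasure d => φ.toMeasure C := by
    intro C hC hb
    -- Thickened indicators of `C` are vaguely continuous test functions converging to the indicator
    -- of `C`; the bound `δ n ≤ 1` puts all their supports in one compact set.
    let δ : ℕ → ℝ := fun n => 1 / ((n : ℝ) + 1)
    have hδ : ∀ n, 0 < δ n := fun n => Nat.one_div_pos_of_nat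
    have hδ1 : ∀ n, δ n ≤ 1 := fun n => by
      simpa [δ] using Nat.one_div_le_one_div (α := ℝ) (Nat.zero_le n)
    have hsupp : ∀ n x, x ∉ Metric.cthickening 1 C → thickenedIndicator (hδ n) C x = 0 := by
      intro n x hx
      exact thickenedIndicator_zero (hδ n) C fun hx' => hx
        (Metric.thickening_subset_cthickening_of_le (hδ1 n) C hx')
    have hK : IsCompact (Metric.cthickening 1 C) :=
      Metric.isCompact_of_isClosed_isBounded Metric.isClosed_cthickening hb.cthickening
    let h : ℕ → CompactlySupportedContinuousMap (EuclideanSpace ℝ (Fin d)) ℝ := fun n =>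
      { toFun := fun x => (thickenedIndicator (hδ n) C x : ℝ)
        continuous_toFun := NNReal.continuous_coe.comp (thickenedIndicator (hδ n) C).continuous
        hasCompactSupport' := HasCompactSupport.intro hK fun x hx => by simp [hsupp n x hx] }
    have hint : ∀ (φ : CountingMeasure d) n,
        ∫⁻ x in Metric.cthickening 1 C, (thickenedIndicator (hδ n) C x : ℝ≥0∞) ∂φ.toMeasure
          = ENNReal.ofReal (∫ x, h n x ∂φ.toMeasure) := by
      intro φ n
      rw [setLIntegral_eq_of_support_subset, ofReal_integral_eq_lintegral_ofReal]
      · simp [h]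
      · exact (h n).continuous.integrable_of_hasCompactSupport (h n).hasCompactSupport
      · exact Eventually.of_forall fun x => NNReal.coe_nonneg _
      · exact fun x hx => by_contra fun hx' => hx (by simp [hsupp n x hx'])
    refine measurable_of_tendsto_metrizable
      (f := fun n (φ : CountingMeasure d) => ENNReal.ofReal (∫ x, h n x ∂φ.toMeasure))
      (fun n => ENNReal.measurable_ofReal.comp (continuous_integral (h n)).measurable)
      (tendsto_pi_nhds.2 fun φ => ?_)
    have : IsFiniteMeasure (φ.toMeasure.restrict (Metric.cthickening 1 C)) :=
      ⟨by simpa using φ.measure_lt_top_of_isBounded hb.cthickening⟩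
    have ht := tendsto_lintegral_thickenedIndicator_of_isClosed
      (φ.toMeasure.restrict (Metric.cthickening 1 C)) hC hδ
      tendsto_one_div_add_atTop_nhds_zero_nat
    rw [Measure.restrict_apply hC.measurableSet,
      inter_eq_self_of_subset_left (Metric.self_subset_cthickening C)] at ht
    simpa only [hint] using ht
  -- Closed sets form a generating π-system, but extending measurability from it needs finite
  -- measures, hence the restriction to balls.
  have hrestr : ∀ n : ℕ, Measurable fun φ : CountingMeasure d =>
      φ.toMeasure.restrict (Metric.closedBall 0 n) := by
    intro n
    have : ∀ φ : CountingMeasure d, IsFiniteMeasure (φ.toMeasure.restrict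
        (Metric.closedBall (0 : EuclideanSpace ℝ (Fin d)) n)) := fun φ =>
      ⟨by simpa using φ.measure_lt_top_of_isBounded Metric.isBounded_closedBall⟩
    have hC : ∀ C : Set (EuclideanSpace ℝ (Fin d)), IsClosed C → Measurable
        fun φ : CountingMeasure d => φ.toMeasure.restrict (Metric.closedBall 0 n) C := by
      intro C hC
      simp only [Measure.restrict_apply hC.measurableSet]
      exact hclosed _ (hC.inter Metric.isClosed_closedBall)
        (Metric.isBounded_closedBall.subset inter_subset_right)
    exact Measurable.measure_of_isPiSystem
      ((BorelSpace.measurable_eq).trans borel_eq_generateFrom_isClosed) isPiSystem_isClosed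
      hC (hC _ isClosed_univ)
  refine Measure.measurable_of_measurable_coe _ fun A hA => ?_
  refine measurable_of_tendsto_metrizable
    (f := fun (n : ℕ) (φ : CountingMeasure d) => φ.toMeasure.restrict (Metric.closedBall 0 n) A)
    (fun n => (Measure.measurable_coe hA).comp (hrestr n)) (tendsto_pi_nhds.2 fun φ => ?_)
  have hmono : Monotone fun n : ℕ => A ∩ Metric.closedBall (0 : EuclideanSpace ℝ (Fin d)) n :=
    fun m n hmn => inter_subset_inter_right _ (Metric.closedBall_subset_closedBall (by simpa))
  have hlim := tendsto_measure_iUnion_atTop (μ := φ.toMeasure) hmono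
  rw [← inter_iUnion, Metric.iUnion_closedBall_nat, inter_univ] at hlim
  simpa only [Measure.restrict_apply hA, Function.comp_def] using hlim

theorem measurable_measure {A : Set (EuclideanSpace ℝ (Fin d))} (hA : MeasurableSet A) :
    Measurable fun φ : CountingMeasure d => φ.toMeasure A :=
  (Measure.measurable_coe hA).comp measurable_toMeasure

theorem measurableSet_hasPoint_zero : MeasurableSet {φ : CountingMeasure d | φ.HasPoint 0} :=
  (measurable_measure (measurableSet_singleton 0) (measurableSet_singleton 0)).compl

theorem measurableEmbedding_val :
    MeasurableEmbedding (Subtype.val : CountingMeasure₀ d → CountingMeasure d) :=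
  MeasurableEmbedding.subtype_coe measurableSet_hasPoint_zero

/-! ### Translations: joint continuity and measurability. -/

theorem integral_shift (φ : CountingMeasure d) (t : EuclideanSpace ℝ (Fin d))
    (h : CompactlySupportedContinuousMap (EuclideanSpace ℝ (Fin d)) ℝ) :
    ∫ x, h x ∂(φ.shift t).toMeasure = ∫ x, h (x - t) ∂φ.toMeasure :=
  integral_map (by fun_prop) h.continuous.aestronglyMeasurable

/-- Translation is jointly continuous for the vague topology. -/
theorem continuous_shift :
    Continuous fun p : EuclideanSpace ℝ (Fin d) × CountingMeasure d => p.2.shift p.1 := by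
  refine continuous_induced_rng.2 (continuous_pi fun h => continuous_iff_continuousAt.2 ?_)
  rintro ⟨t₀, φ₀⟩
  simp only [ContinuousAt, Function.comp_apply, integral_shift]
  obtain ⟨R, hR⟩ := h.hasCompactSupport.isCompact.isBounded.subset_closedBall 0
  -- `χ` equals `1` on a ball containing the supports of all `h (· - t)` with `‖t - t₀‖ < 1`. It
  -- turns the uniform bound on `h (· - t) - h (· - t₀)` into an integral bound valid for all `φ`
  -- near `φ₀`.
  obtain ⟨χ, hχ1, -, hχc, hχ01⟩ := exists_continuous_one_zero_of_isCompact
    (isCompact_closedBall (0 : EuclideanSpace ℝ (Fin d)) (R + ‖t₀‖ + 1)) isClosed_empty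
    (disjoint_empty _)
  let χ' : CompactlySupportedContinuousMap (EuclideanSpace ℝ (Fin d)) ℝ :=
    { toFun := χ, continuous_toFun := χ.continuous, hasCompactSupport' := hχc }
  have hunif := h.continuous.uniformContinuous_of_tendsto_cocompact
    h.hasCompactSupport.is_zero_at_infty
  have hcomp : ∀ t, HasCompactSupport fun x => h (x - t) := fun t =>
    h.hasCompactSupport.comp_homeomorph (Homeomorph.subRight t)
  have hint : ∀ (φ : CountingMeasure d) t, Integrable (fun x => h (x - t)) φ.toMeasure :=
    fun φ t => Continuous.integrable_of_hasCompactSupport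
      (h.continuous.comp (continuous_id.sub continuous_const)) (hcomp t)
  have hχint : ∀ φ : CountingMeasure d, Integrable χ φ.toMeasure := fun φ =>
    χ.continuous.integrable_of_hasCompactSupport hχc
  let h₀ : CompactlySupportedContinuousMap (EuclideanSpace ℝ (Fin d)) ℝ :=
    { toFun := fun x => h (x - t₀)
      continuous_toFun := h.continuous.comp (continuous_id.sub continuous_const)
      hasCompactSupport' := hcomp t₀ }
  have hcont₀ : Tendsto (fun p : EuclideanSpace ℝ (Fin d) × CountingMeasure d =>
      ∫ x, h (x - t₀) ∂p.2.toMeasure) (𝓝 (t₀, φ₀)) (𝓝 (∫ x, h (x - t₀) ∂φ₀.toMeasure)) :=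
    ((continuous_integral h₀).comp continuous_snd).tendsto (t₀, φ₀)
  have hdiff : Tendsto (fun p : EuclideanSpace ℝ (Fin d) × CountingMeasure d =>
      ∫ x, h (x - p.1) ∂p.2.toMeasure - ∫ x, h (x - t₀) ∂p.2.toMeasure) (𝓝 (t₀, φ₀)) (𝓝 0) := by
    rw [Metric.tendsto_nhds]
    intro ε hε
    set M := ∫ x, χ x ∂φ₀.toMeasure with hM
    have hM0 : 0 ≤ M := integral_nonneg fun x => (hχ01 x).1
    -- Near `φ₀` the integral of `χ` is below `M + 1`; dividing by `M + 2` keeps the final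
    -- inequality strict.
    obtain ⟨δ, hδ, hδh⟩ := Metric.uniformContinuous_iff.1 hunif (ε / (M + 2)) (by positivity)
    have hev : ∀ᶠ p : EuclideanSpace ℝ (Fin d) × CountingMeasure d in 𝓝 (t₀, φ₀),
        ∫ x, χ x ∂p.2.toMeasure < M + 1 :=
      (((continuous_integral χ').comp continuous_snd).tendsto (t₀, φ₀)).eventually_lt_const
        (lt_add_one M)
    have hev' : ∀ᶠ p : EuclideanSpace ℝ (Fin d) × CountingMeasure d in 𝓝 (t₀, φ₀),
        dist p.1 t₀ < min δ 1 :=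
      (continuous_fst.tendsto (t₀, φ₀)).eventually (Metric.ball_mem_nhds t₀ (by positivity))
    filter_upwards [hev, hev'] with p hp hp'
    have hpδ := hp'.trans_le (min_le_left _ _)
    have hp1 := hp'.trans_le (min_le_right _ _)
    rw [dist_zero_right, ← integral_sub (hint _ _) (hint _ _)]
    have hbound : ∀ x, ‖h (x - p.1) - h (x - t₀)‖ ≤ ε / (M + 2) * χ x := by
      intro x
      by_cases hx : x ∈ Metric.closedBall 0 (R + ‖t₀‖ + 1)
      · rw [hχ1 hx, Pi.one_apply, mul_one, ← dist_eq_norm]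
        exact (hδh (by rwa [dist_sub_left])).le
      · have hz : ∀ t, dist t t₀ < 1 → h (x - t) = 0 := by
          intro t ht
          by_contra hne
          have h1 := hR (subset_tsupport _ hne)
          rw [mem_closedBall_zero_iff] at h1 hx
          rw [dist_eq_norm] at ht
          refine hx ?_
          calc ‖x‖ = ‖(x - t) + (t - t₀) + t₀‖ := by congr 1; abel
            _ ≤ ‖x - t‖ + ‖t - t₀‖ + ‖t₀‖ := norm_add₃_le
            _ ≤ R + ‖t₀‖ + 1 := by linarith
        rw [hz _ hp1, hz _ (by simp)]
        have := (hχ01 x).1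
        simp only [sub_self, norm_zero]
        positivity
    calc ‖∫ x, (h (x - p.1) - h (x - t₀)) ∂p.2.toMeasure‖
        ≤ ∫ x, ε / (M + 2) * χ x ∂p.2.toMeasure :=
          norm_integral_le_of_norm_le ((hχint _).const_mul _) (Eventually.of_forall hbound)
      _ = ε / (M + 2) * ∫ x, χ x ∂p.2.toMeasure := integral_const_mul _ _
      _ ≤ ε / (M + 2) * (M + 1) := by gcongr
      _ < ε / (M + 2) * (M + 2) := by gcongr; linarith
      _ = ε := by field_simp
  simpa using hdiff.add hcont₀

theorem measurable_shift :
    Measurable fun p : EuclideanSpace ℝ (Fin d) × CountingMeasure d => p.2.shift p.1 :=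
  continuous_shift.measurable

@[simp]
theorem shift_zero (φ : CountingMeasure d) : φ.shift 0 = φ := by
  cases φ; simp [shift]

theorem shift_shift (φ : CountingMeasure d) (s t : EuclideanSpace ℝ (Fin d)) :
    (φ.shift s).shift t = φ.shift (s + t) := by
  simp only [shift, mk.injEq]
  rw [Measure.map_map (by fun_prop) (by fun_prop)]
  congr 1
  funext x
  simp [sub_sub]

theorem shift_singleton (φ : CountingMeasure d) (t x : EuclideanSpace ℝ (Fin d)) :
    (φ.shift t).toMeasure {x} = φ.toMeasure {x + t} := by
  rw [shift, Measure.map_apply (by fun_prop) (measurableSet_singleton x)]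
  congr 1
  ext y; simp [sub_eq_iff_eq_add]

theorem measurableSet_hasPoint :
    MeasurableSet {p : CountingMeasure d × EuclideanSpace ℝ (Fin d) | p.1.HasPoint p.2} := by
  have h : {p : CountingMeasure d × EuclideanSpace ℝ (Fin d) | p.1.HasPoint p.2}
      = (fun p => p.1.shift p.2) ⁻¹' {φ : CountingMeasure d | φ.HasPoint 0} := by
    ext p; simp [shift_hasPoint]
  rw [h]
  exact (measurable_shift.comp measurable_swap) measurableSet_hasPoint_zero

end CountingMeasure

/-! ### The unit cube and the flow. -/

/-- The half-open unit cube of `ℝ^d`. -/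
def unitCube (d : ℕ) : Set (EuclideanSpace ℝ (Fin d)) := {x | ∀ i, x i ∈ Ico (0 : ℝ) 1}

theorem unitCube_eq_preimage (d : ℕ) :
    unitCube d = WithLp.ofLp ⁻¹' univ.pi fun _ : Fin d => Ico (0 : ℝ) 1 := by
  ext x; simp [unitCube]

theorem measurableSet_unitCube (d : ℕ) : MeasurableSet (unitCube d) := by
  rw [unitCube_eq_preimage]
  exact (PiLp.volume_preserving_ofLp (Fin d)).measurable
    (MeasurableSet.univ_pi fun _ => measurableSet_Ico)

theorem volume_unitCube (d : ℕ) : volume (unitCube d) = 1 := by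
  rw [unitCube_eq_preimage, (PiLp.volume_preserving_ofLp (Fin d)).measure_preimage
    (MeasurableSet.univ_pi fun _ => measurableSet_Ico).nullMeasurableSet, Real.volume_pi_Ico]
  simp

theorem nonempty_interior_unitCube (d : ℕ) : (interior (unitCube d)).Nonempty := by
  have hopen : IsOpen {x : EuclideanSpace ℝ (Fin d) | ∀ i, x i ∈ Ioo (0 : ℝ) 1} := by
    simp only [ofPred_forall]
    exact isOpen_iInter_of_finite fun i =>
      isOpen_Ioo.preimage (by fun_prop : Continuous fun x : EuclideanSpace ℝ (Fin d) => x i)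
  refine ⟨WithLp.toLp 2 fun _ => 1 / 2, interior_maximal ?_ hopen ?_⟩
  · exact fun x hx i => Ioo_subset_Ico_self (hx i)
  · intro i; norm_num

namespace MeasurableFlow

variable {d : ℕ} {Ω : Type*} [MeasurableSpace Ω] (θ : MeasurableFlow d Ω)

theorem measurable_toFun (t : EuclideanSpace ℝ (Fin d)) : Measurable (θ.toFun t) :=
  θ.measurable'.comp (measurable_const.prodMk measurable_id)

theorem measurable_orbit (ω : Ω) : Measurable fun t => θ.toFun t ω :=
  θ.measurable'.comp (measurable_id.prodMk measurable_const)

end MeasurableFlow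

/-! ### The tautological kernel is s-finite. -/

namespace CountingMeasure

variable {d : ℕ}

open ProbabilityTheory

/-- The tautological kernel from the space of counting measures to `ℝ^d`. -/
noncomputable def kernel (d : ℕ) : Kernel (CountingMeasure d) (EuclideanSpace ℝ (Fin d)) :=
  ⟨toMeasure, measurable_toMeasure⟩

/-- The mass of `A` is finite for each `φ` but not uniformly bounded. Slicing the space according to
the integer value `φ(A) = n` gives countably many finite kernels. -/
theorem isSFiniteKernel_restrict {A : Set (EuclideanSpace ℝ (Fin d))} (hA : MeasurableSet A)
    (hb : Bornology.IsBounded A) : IsSFiniteKernel ((kernel d).restrict hA) := by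
  classical
  have hS : ∀ n : ℕ, MeasurableSet {φ : CountingMeasure d | φ.toMeasure A = n} := fun n =>
    measurable_measure hA (measurableSet_singleton _)
  have hfin : ∀ n, IsFiniteKernel (Kernel.piecewise (hS n) ((kernel d).restrict hA) 0) := by
    refine fun n => ⟨⟨n, ENNReal.natCast_lt_top n, fun φ => ?_⟩⟩
    rw [Kernel.piecewise_apply']
    split_ifs with h
    · rw [Kernel.restrict_apply, Measure.restrict_apply_univ]
      exact le_of_eq h
    · simp
  have heq : (kernel d).restrict hA
      = Kernel.sum fun n => Kernel.piecewise (hS n) ((kernel d).restrict hA) 0 := by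
    ext φ s hs
    obtain ⟨n, hn⟩ := φ.exists_nat' A hA hb
    rw [Kernel.sum_apply' _ _ hs, tsum_eq_single n]
    · rw [Kernel.piecewise_apply']
      exact (if_pos hn).symm
    · intro m hm
      rw [Kernel.piecewise_apply', if_neg]
      · simp
      · intro h
        rw [mem_ofPred_eq, hn] at h
        exact hm (by exact_mod_cast h.symm)
  rw [heq]
  infer_instance

instance : IsSFiniteKernel (kernel d) := by
  let A : ℕ → Set (EuclideanSpace ℝ (Fin d)) := disjointed fun n : ℕ => Metric.closedBall 0 n
  have hA : ∀ n, MeasurableSet (A n) := fun n =>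
    MeasurableSet.disjointed (fun n => Metric.isClosed_closedBall.measurableSet) n
  have hb : ∀ n, Bornology.IsBounded (A n) := fun n =>
    Metric.isBounded_closedBall.subset (disjointed_subset _ n)
  have heq : kernel d = Kernel.sum fun n => (kernel d).restrict (hA n) := by
    ext φ s hs
    rw [Kernel.sum_apply, ← Measure.restrict_univ (μ := kernel d φ),
      ← Metric.iUnion_closedBall_nat (0 : EuclideanSpace ℝ (Fin d)), ← iUnion_disjointed,
      Measure.restrict_iUnion (disjoint_disjointed _) hA]
    simp only [Kernel.restrict_apply]
    rfl
  rw [heq]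
  have := fun n => isSFiniteKernel_restrict (hA n) (hb n)
  infer_instance

end CountingMeasure

/-! ### The Campbell measure and the refined Campbell theorem. -/

section Campbell

open ProbabilityTheory

variable {d : ℕ} {Ω : Type*} [MeasurableSpace Ω] {θ : MeasurableFlow d Ω} {P : Measure Ω}
  {Φ : Ω → CountingMeasure d}

namespace IsStationaryPointProcess

/-- A point process, as a kernel. -/
noncomputable def kernel (hΦ : IsStationaryPointProcess θ P Φ) :
    Kernel Ω (EuclideanSpace ℝ (Fin d)) :=
  (CountingMeasure.kernel d).comap Φ hΦ.measurable

instance (hΦ : IsStationaryPointProcess θ P Φ) : IsSFiniteKernel hΦ.kernel := by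
  unfold kernel; infer_instance

theorem measurable_lintegral (hΦ : IsStationaryPointProcess θ P Φ)
    {f : Ω × EuclideanSpace ℝ (Fin d) → ℝ≥0∞} (hf : Measurable f) :
    Measurable fun ω => ∫⁻ x, f (ω, x) ∂(Φ ω).toMeasure :=
  hf.lintegral_kernel_prod_right' (κ := hΦ.kernel)

/-- The Campbell measure `(A, F) ↦ 𝔼 ∑_{x ∈ Φ ∩ A} 1 {θ_x ∈ F}`. -/
noncomputable def campbell (hΦ : IsStationaryPointProcess θ P Φ) :
    Measure (EuclideanSpace ℝ (Fin d) × Ω) :=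
  (P ⊗ₘ hΦ.kernel).map fun p => (p.2, θ.toFun p.2 p.1)

/-- The Palm measure, normalised to have total mass the intensity of `Φ`. -/
noncomputable def palmMeasure (hΦ : IsStationaryPointProcess θ P Φ) : Measure Ω :=
  (hΦ.campbell.restrict (unitCube d ×ˢ univ)).map Prod.snd

theorem measurable_prodMk_flow (θ : MeasurableFlow d Ω) :
    Measurable fun p : Ω × EuclideanSpace ℝ (Fin d) => (p.2, θ.toFun p.2 p.1) :=
  measurable_snd.prodMk (θ.measurable'.comp measurable_swap)

theorem palmMeasure_apply (hΦ : IsStationaryPointProcess θ P Φ) {F : Set Ω}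
    (hF : MeasurableSet F) : hΦ.palmMeasure F = hΦ.campbell (unitCube d ×ˢ F) := by
  rw [palmMeasure, Measure.map_apply measurable_snd hF,
    Measure.restrict_apply (measurable_snd hF)]
  congr 1
  ext p; simp [and_comm]

variable [IsProbabilityMeasure P]

theorem lintegral_campbell (hΦ : IsStationaryPointProcess θ P Φ)
    {k : EuclideanSpace ℝ (Fin d) × Ω → ℝ≥0∞} (hk : Measurable k) :
    ∫⁻ p, k p ∂hΦ.campbell = ∫⁻ ω, ∫⁻ x, k (x, θ.toFun x ω) ∂(Φ ω).toMeasure ∂P := by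
  rw [campbell, lintegral_map hk (measurable_prodMk_flow θ),
    Measure.lintegral_compProd (f := fun p => k (p.2, θ.toFun p.2 p.1))
      (hk.comp (measurable_prodMk_flow θ))]
  rfl

theorem campbell_prod (hΦ : IsStationaryPointProcess θ P Φ)
    {A : Set (EuclideanSpace ℝ (Fin d))} (hA : MeasurableSet A) {F : Set Ω}
    (hF : MeasurableSet F) :
    hΦ.campbell (A ×ˢ F) = ∫⁻ ω, ∫⁻ x,
      A.indicator 1 x * F.indicator 1 (θ.toFun x ω) ∂(Φ ω).toMeasure ∂P := by
  rw [← lintegral_indicator_one (hA.prod hF), lintegral_campbell hΦ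
    (measurable_one.indicator (hA.prod hF))]
  refine lintegral_congr fun ω => lintegral_congr fun x => ?_
  by_cases hx : x ∈ A <;> by_cases hy : θ.toFun x ω ∈ F <;> simp [hx, hy]

theorem campbell_unitCube (hΦ : IsStationaryPointProcess θ P Φ) :
    hΦ.campbell (unitCube d ×ˢ univ) = intensity P fun ω => (Φ ω).toMeasure := by
  rw [campbell_prod hΦ (measurableSet_unitCube d) MeasurableSet.univ]
  simp only [indicator_univ, Pi.one_apply, mul_one]
  exact lintegral_congr fun ω => lintegral_indicator_one (measurableSet_unitCube d)

theorem palmMeasure_univ (hΦ : IsStationaryPointProcess θ P Φ) :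
    hΦ.palmMeasure univ = intensity P fun ω => (Φ ω).toMeasure := by
  rw [palmMeasure_apply hΦ MeasurableSet.univ, campbell_unitCube]

/-- Replacing `ω` by `θ_{-s} ω` moves every point `x` to `x + s` but leaves the mark unchanged,
since `θ_{x+s} θ_{-s} = θ_x`. Invariance of `P` does the rest. -/
theorem campbell_preimage_add (hΦ : IsStationaryPointProcess θ P Φ)
    {A : Set (EuclideanSpace ℝ (Fin d))} (hA : MeasurableSet A) {F : Set Ω}
    (hF : MeasurableSet F) (s : EuclideanSpace ℝ (Fin d)) :
    hΦ.campbell (((fun x => s + x) ⁻¹' A) ×ˢ F) = hΦ.campbell (A ×ˢ F) := by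
  have hA' : MeasurableSet ((fun x => s + x) ⁻¹' A) := (measurable_const_add s) hA
  have hm : Measurable fun p : Ω × EuclideanSpace ℝ (Fin d) =>
      A.indicator (1 : EuclideanSpace ℝ (Fin d) → ℝ≥0∞) p.2
        * F.indicator (1 : Ω → ℝ≥0∞) (θ.toFun p.2 p.1) :=
    ((measurable_one.indicator hA).comp measurable_snd).mul
      ((measurable_one.indicator hF).comp (θ.measurable'.comp measurable_swap))
  rw [campbell_prod hΦ hA hF, campbell_prod hΦ hA' hF]
  conv_rhs => rw [← hΦ.invariant (-s)]
  rw [lintegral_map (hΦ.measurable_lintegral hm) (θ.measurable_toFun _)]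
  refine lintegral_congr fun ω => ?_
  have hmx : Measurable fun x : EuclideanSpace ℝ (Fin d) =>
      A.indicator (1 : EuclideanSpace ℝ (Fin d) → ℝ≥0∞) x
        * F.indicator (1 : Ω → ℝ≥0∞) (θ.toFun x (θ.toFun (-s) ω)) :=
    hm.comp (measurable_const.prodMk measurable_id)
  rw [hΦ.compatible, CountingMeasure.shift, lintegral_map hmx (by fun_prop)]
  refine lintegral_congr fun x => ?_
  rw [← θ.add']
  simp only [sub_neg_eq_add, add_neg_cancel_right]
  rw [add_comm x s]
  rfl

/-- For fixed `F`, the measure `A ↦ campbell (A ×ˢ F)` is translation invariant and finite on the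
unit cube, hence a multiple of Lebesgue measure. The unit cube, of volume `1`, identifies the
constant. -/
theorem volume_prod_palmMeasure (hΦ : IsStationaryPointProcess θ P Φ)
    (hfin : intensity P (fun ω => (Φ ω).toMeasure) ≠ ⊤) :
    (volume : Measure (EuclideanSpace ℝ (Fin d))).prod hΦ.palmMeasure = hΦ.campbell := by
  have : IsFiniteMeasure hΦ.palmMeasure :=
    ⟨by rw [palmMeasure_univ]; exact lt_top_iff_ne_top.2 hfin⟩
  refine Measure.prod_eq fun A F hA hF => ?_
  let ν : Measure (EuclideanSpace ℝ (Fin d)) := (hΦ.campbell.restrict (univ ×ˢ F)).map Prod.fst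
  have hν : ∀ A, MeasurableSet A → ν A = hΦ.campbell (A ×ˢ F) := by
    intro A hA
    rw [Measure.map_apply measurable_fst hA, Measure.restrict_apply (measurable_fst hA)]
    congr 1
    ext p; simp
  have hinv : ν.IsAddLeftInvariant := by
    refine ⟨fun s => Measure.ext fun A hA => ?_⟩
    rw [Measure.map_apply (measurable_const_add s) hA, hν _ hA, hν _ (measurable_const_add s hA),
      campbell_preimage_add hΦ hA hF]
  have hfinν : ν (unitCube d) ≠ ⊤ := by
    rw [hν _ (measurableSet_unitCube d)]
    refine ne_top_of_le_ne_top hfin ?_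
    rw [← hΦ.campbell_unitCube]
    exact measure_mono (prod_mono_right (subset_univ _))
  -- An invariant measure finite on a set with nonempty interior is finite on compacts, as Haar
  -- uniqueness requires.
  have hcpt : IsFiniteMeasureOnCompacts ν := ⟨fun K hK =>
    measure_lt_top_of_isCompact_of_isAddLeftInvariant' (nonempty_interior_unitCube d) hfinν hK⟩
  obtain ⟨c, hc⟩ : ∃ c : ℝ≥0∞, ∀ A, ν A = c * volume A := by
    refine ⟨(ν.addHaarScalarFactor volume : NNReal), fun A => ?_⟩
    conv_lhs => rw [Measure.isAddLeftInvariant_eq_smul ν volume]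
    rfl
  have hcube : hΦ.palmMeasure F = c := by
    rw [palmMeasure_apply hΦ hF, ← hν _ (measurableSet_unitCube d), hc, volume_unitCube, mul_one]
  rw [← hν A hA, hcube, hc, mul_comm]

/-- The refined Campbell theorem. -/
theorem lintegral_lintegral_flow (hΦ : IsStationaryPointProcess θ P Φ)
    (hfin : intensity P (fun ω => (Φ ω).toMeasure) ≠ ⊤)
    {k : EuclideanSpace ℝ (Fin d) × Ω → ℝ≥0∞} (hk : Measurable k) :
    ∫⁻ ω, ∫⁻ x, k (x, θ.toFun x ω) ∂(Φ ω).toMeasure ∂P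
      = ∫⁻ ω, (∫⁻ x, k (x, ω)) ∂hΦ.palmMeasure := by
  have : IsFiniteMeasure hΦ.palmMeasure :=
    ⟨by rw [palmMeasure_univ]; exact lt_top_iff_ne_top.2 hfin⟩
  rw [← lintegral_campbell hΦ hk, ← volume_prod_palmMeasure hΦ hfin,
    lintegral_prod_symm' _ hk]

end IsStationaryPointProcess

end Campbell

/-! ### Orbits of the point-shift and their limits. -/

namespace PointMap

variable {d : ℕ} (g : PointMap d)

theorem pointShift_of_hasPoint {φ : CountingMeasure d} {x : EuclideanSpace ℝ (Fin d)}
    (h : φ.HasPoint x) : g.pointShift φ x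
      = x + g.toFun ⟨φ.shift x, CountingMeasure.shift_hasPoint.2 (by simpa using h)⟩ :=
  dif_pos h

theorem pointShift_of_not_hasPoint {φ : CountingMeasure d} {x : EuclideanSpace ℝ (Fin d)}
    (h : ¬φ.HasPoint x) : g.pointShift φ x = x :=
  dif_neg h

theorem hasPoint_pointShift {φ : CountingMeasure d} {x : EuclideanSpace ℝ (Fin d)}
    (h : φ.HasPoint x) : φ.HasPoint (g.pointShift φ x) := by
  rw [g.pointShift_of_hasPoint h, add_comm]
  exact CountingMeasure.shift_hasPoint.1 (g.hasPoint' ⟨φ.shift x, _⟩)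

theorem hasPoint_iterate_pointShift {φ : CountingMeasure d} {x : EuclideanSpace ℝ (Fin d)}
    (h : φ.HasPoint x) (n : ℕ) : φ.HasPoint ((g.pointShift φ)^[n] x) := by
  induction n with
  | zero => exact h
  | succ n ih => rw [Function.iterate_succ_apply']; exact g.hasPoint_pointShift ih

/-- Translation covariance. Leaving non-points fixed makes it hold for every `x`. -/
theorem pointShift_shift (φ : CountingMeasure d) (t x : EuclideanSpace ℝ (Fin d)) :
    g.pointShift (φ.shift t) x = g.pointShift φ (x + t) - t := by
  by_cases h : φ.HasPoint (x + t)
  · rw [g.pointShift_of_hasPoint h,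
      g.pointShift_of_hasPoint (CountingMeasure.shift_hasPoint.2 h)]
    simp only [φ.shift_shift, add_comm t x]
    abel
  · rw [g.pointShift_of_not_hasPoint h, g.pointShift_of_not_hasPoint fun h' =>
      h (CountingMeasure.shift_hasPoint.1 h'), add_sub_cancel_right]

theorem iterate_pointShift_shift (φ : CountingMeasure d) (t x : EuclideanSpace ℝ (Fin d))
    (n : ℕ) : (g.pointShift (φ.shift t))^[n] x = (g.pointShift φ)^[n] (x + t) - t := by
  induction n with
  | zero => simp
  | succ n ih =>
    rw [Function.iterate_succ_apply', Function.iterate_succ_apply', ih, pointShift_shift,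
      sub_add_cancel]

/-- The orbit of `x` under the point-shift is eventually constant. -/
def EventuallyFixed (φ : CountingMeasure d) (x : EuclideanSpace ℝ (Fin d)) : Prop :=
  ∃ N : ℕ, ∀ n ≥ N, (g.pointShift φ)^[n] x = (g.pointShift φ)^[N] x

variable {g}

theorem eventuallyFixed_of_periodic {φ : CountingMeasure d} {x : EuclideanSpace ℝ (Fin d)}
    (h : ∃ N : ℕ, ∀ n ≥ N, (g.pointShift φ)^[n] x = (g.pointShift φ)^[n + 1] x) :
    g.EventuallyFixed φ x := by
  obtain ⟨N, hN⟩ := h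
  refine ⟨N, fun n hn => ?_⟩
  induction n, hn using Nat.le_induction with
  | base => rfl
  | succ n hn ih => rw [← hN n hn, ih]

theorem eventuallyFixed_shift {φ : CountingMeasure d} {t x : EuclideanSpace ℝ (Fin d)} :
    g.EventuallyFixed (φ.shift t) x ↔ g.EventuallyFixed φ (x + t) := by
  simp only [EventuallyFixed, iterate_pointShift_shift, sub_left_inj]

theorem EventuallyFixed.eventually_eq {φ : CountingMeasure d} {x : EuclideanSpace ℝ (Fin d)}
    (h : g.EventuallyFixed φ x) :
    ∀ᶠ n in atTop, (g.pointShift φ)^[n] x = g.limitShift φ x := by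
  classical
  rw [limitShift, dif_pos (show ∃ N : ℕ, _ from h)]
  filter_upwards [eventually_ge_atTop (Nat.find h)] with n hn using Nat.find_spec h n hn

theorem limitShift_of_not_eventuallyFixed {φ : CountingMeasure d}
    {x : EuclideanSpace ℝ (Fin d)} (h : ¬g.EventuallyFixed φ x) : g.limitShift φ x = x := by
  exact dif_neg h

theorem EventuallyFixed.iterate {φ : CountingMeasure d} {x : EuclideanSpace ℝ (Fin d)}
    (h : g.EventuallyFixed φ x) (m : ℕ) : g.EventuallyFixed φ ((g.pointShift φ)^[m] x) := by
  obtain ⟨N, hN⟩ := h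
  refine ⟨N, fun n hn => ?_⟩
  rw [← Function.iterate_add_apply, ← Function.iterate_add_apply, hN (n + m) (by omega),
    hN (N + m) (by omega)]

theorem EventuallyFixed.limitShift_iterate {φ : CountingMeasure d}
    {x : EuclideanSpace ℝ (Fin d)} (h : g.EventuallyFixed φ x) (m : ℕ) :
    g.limitShift φ ((g.pointShift φ)^[m] x) = g.limitShift φ x := by
  obtain ⟨n, hn, hn'⟩ := ((h.iterate m).eventually_eq.and
    ((tendsto_add_atTop_nat m).eventually h.eventually_eq)).exists
  rw [← hn, ← hn', Function.iterate_add_apply]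

theorem EventuallyFixed.limitShift_limitShift {φ : CountingMeasure d}
    {x : EuclideanSpace ℝ (Fin d)} (h : g.EventuallyFixed φ x) :
    g.limitShift φ (g.limitShift φ x) = g.limitShift φ x := by
  obtain ⟨n, hn⟩ := h.eventually_eq.exists
  rw [← hn, h.limitShift_iterate, hn]

variable (g)

theorem hasPoint_limitShift {φ : CountingMeasure d} {x : EuclideanSpace ℝ (Fin d)}
    (h : φ.HasPoint x) : φ.HasPoint (g.limitShift φ x) := by
  by_cases hx : g.EventuallyFixed φ x
  · obtain ⟨n, hn⟩ := hx.eventually_eq.exists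
    rw [← hn]
    exact g.hasPoint_iterate_pointShift h n
  · rwa [limitShift_of_not_eventuallyFixed hx]

theorem limitShift_shift (φ : CountingMeasure d) (t x : EuclideanSpace ℝ (Fin d)) :
    g.limitShift (φ.shift t) x = g.limitShift φ (x + t) - t := by
  by_cases hx : g.EventuallyFixed φ (x + t)
  · obtain ⟨n, hn, hn'⟩ :=
      (hx.eventually_eq.and (eventuallyFixed_shift.2 hx).eventually_eq).exists
    rw [← hn, ← hn', iterate_pointShift_shift]
  · rw [limitShift_of_not_eventuallyFixed hx,
      limitShift_of_not_eventuallyFixed (mt eventuallyFixed_shift.1 hx), add_sub_cancel_right]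

/-! ### Joint measurability of the point-shift, its iterates and its limit. -/

theorem measurable_pointShift :
    Measurable fun p : CountingMeasure d × EuclideanSpace ℝ (Fin d) => g.pointShift p.1 p.2 := by
  let s : Set (CountingMeasure d × EuclideanSpace ℝ (Fin d)) := {p | p.1.HasPoint p.2}
  refine measurable_of_restrict_of_restrict_compl (s := s)
    CountingMeasure.measurableSet_hasPoint ?_ ?_
  · have hm : Measurable fun a : s => (⟨a.1.1.shift a.1.2, CountingMeasure.shift_hasPoint.2
        (by simpa using (show a.1.1.HasPoint a.1.2 from a.2))⟩ : CountingMeasure₀ d) :=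
      Measurable.subtype_mk (CountingMeasure.measurable_shift.comp
        (measurable_swap.comp measurable_subtype_coe))
    have heq : s.domRestrict (fun p => g.pointShift p.1 p.2) = fun a : s =>
        a.1.2 + g.toFun ⟨a.1.1.shift a.1.2, CountingMeasure.shift_hasPoint.2
          (by simpa using (show a.1.1.HasPoint a.1.2 from a.2))⟩ :=
      funext fun a => g.pointShift_of_hasPoint a.2
    rw [heq]
    exact (measurable_snd.comp measurable_subtype_coe).add (g.measurable'.comp hm)
  · have heq : sᶜ.domRestrict (fun p => g.pointShift p.1 p.2) = fun a => a.1.2 :=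
      funext fun a => g.pointShift_of_not_hasPoint a.2
    rw [heq]
    exact measurable_snd.comp measurable_subtype_coe

theorem measurable_iterate_pointShift (n : ℕ) :
    Measurable fun p : CountingMeasure d × EuclideanSpace ℝ (Fin d) =>
      (g.pointShift p.1)^[n] p.2 := by
  induction n with
  | zero => exact measurable_snd
  | succ n ih =>
    simp only [Function.iterate_succ_apply']
    exact g.measurable_pointShift.comp (measurable_fst.prodMk ih)

theorem measurableSet_eventuallyFixed :
    MeasurableSet {p : CountingMeasure d × EuclideanSpace ℝ (Fin d) |
      g.EventuallyFixed p.1 p.2} := by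
  simp only [EventuallyFixed, ofPred_exists, ofPred_forall]
  exact MeasurableSet.iUnion fun N => MeasurableSet.iInter fun n => MeasurableSet.iInter fun _ =>
    measurableSet_eq_fun (g.measurable_iterate_pointShift n) (g.measurable_iterate_pointShift N)

/-- The limit is a pointwise limit of iterates, once these are replaced by the default value `x` off
the measurable set of eventually fixed pairs. -/
theorem measurable_limitShift :
    Measurable fun p : CountingMeasure d × EuclideanSpace ℝ (Fin d) => g.limitShift p.1 p.2 := by
  classical
  refine measurable_of_tendsto_metrizable
    (f := fun n (p : CountingMeasure d × EuclideanSpace ℝ (Fin d)) =>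
      if g.EventuallyFixed p.1 p.2 then (g.pointShift p.1)^[n] p.2 else p.2)
    (fun n => Measurable.ite g.measurableSet_eventuallyFixed
      (g.measurable_iterate_pointShift n) measurable_snd) (tendsto_pi_nhds.2 fun p => ?_)
  by_cases h : g.EventuallyFixed p.1 p.2
  · simp only [if_pos h]
    exact tendsto_const_nhds.congr' (h.eventually_eq.mono fun n hn => hn.symm)
  · simp only [if_neg h, limitShift_of_not_eventuallyFixed h]
    exact tendsto_const_nhds

theorem measurable_limitShift_right (φ : CountingMeasure d) : Measurable (g.limitShift φ) :=
  g.measurable_limitShift.comp (measurable_const.prodMk measurable_id)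

theorem measurable_iterate_pointShift_right (φ : CountingMeasure d) (n : ℕ) :
    Measurable ((g.pointShift φ)^[n]) :=
  (g.measurable_iterate_pointShift n).comp (measurable_const.prodMk measurable_id)

/-! ### The limit image: density, local finiteness, stabilisation. -/

theorem limitImage_apply (φ : CountingMeasure d) {A : Set (EuclideanSpace ℝ (Fin d))}
    (hA : MeasurableSet A) : g.limitImage φ A = φ.toMeasure (g.limitShift φ ⁻¹' A) :=
  Measure.map_apply (g.measurable_limitShift_right φ) hA

theorem measurable_limitImage {A : Set (EuclideanSpace ℝ (Fin d))} (hA : MeasurableSet A) :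
    Measurable fun φ => g.limitImage φ A := by
  simp only [g.limitImage_apply _ hA]
  exact ProbabilityTheory.Kernel.measurable_kernel_prodMk_left
    (κ := CountingMeasure.kernel d) (g.measurable_limitShift hA)

theorem limitImage_shift_singleton (φ : CountingMeasure d) (t x : EuclideanSpace ℝ (Fin d)) :
    g.limitImage (φ.shift t) {x} = g.limitImage φ {x + t} := by
  rw [g.limitImage_apply _ (measurableSet_singleton _),
    g.limitImage_apply _ (measurableSet_singleton _)]
  refine (Measure.map_apply (by fun_prop)
    (g.measurable_limitShift_right (φ.shift t) (measurableSet_singleton _))).trans ?_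
  congr 1
  ext y
  simp only [mem_preimage, mem_singleton_iff]
  rw [limitShift_shift, sub_add_cancel, sub_eq_iff_eq_add]

/-- The limit image of `φ` is carried by the points of `φ`. -/
theorem ae_hasPoint_limitImage (φ : CountingMeasure d) :
    ∀ᵐ x ∂g.limitImage φ, φ.HasPoint x := by
  rw [limitImage, ae_map_iff (g.measurable_limitShift_right φ).aemeasurable
    φ.measurableSet_setOf_hasPoint]
  filter_upwards [φ.ae_hasPoint] with x hx using g.hasPoint_limitShift hx

/-- The limit image of `φ` has a density with respect to `φ`. -/
theorem lintegral_limitImage (φ : CountingMeasure d) {h : EuclideanSpace ℝ (Fin d) → ℝ≥0∞} :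
    ∫⁻ x, h x ∂g.limitImage φ
      = ∫⁻ x, h x * (g.limitImage φ {x} / φ.toMeasure {x}) ∂φ.toMeasure := by
  have h1 : (g.limitImage φ).restrict {x | φ.HasPoint x} = g.limitImage φ :=
    Measure.restrict_eq_self_of_ae_mem (g.ae_hasPoint_limitImage φ)
  have h2 : φ.toMeasure.restrict {x | φ.HasPoint x} = φ.toMeasure :=
    Measure.restrict_eq_self_of_ae_mem φ.ae_hasPoint
  -- Both measures live on the countable set of points of `φ`, so both integrals are sums over it.
  -- The atoms `φ{x}` cancel, being nonzero and finite.
  rw [← h1, lintegral_countable _ φ.countable_setOf_hasPoint, h1]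
  conv_rhs => rw [← h2, lintegral_countable _ φ.countable_setOf_hasPoint]
  refine tsum_congr fun x => ?_
  rw [mul_assoc, h2, ENNReal.div_mul_cancel x.2
    (φ.measure_lt_top_of_isBounded Bornology.isBounded_singleton).ne]

variable {g}

theorem exists_toMeasure_eq_limitImage {φ : CountingMeasure d}
    (h : ∀ n : ℕ, g.limitImage φ (Metric.closedBall 0 n) ≠ ⊤) :
    ∃ ψ : CountingMeasure d, ψ.toMeasure = g.limitImage φ := by
  refine ⟨⟨g.limitImage φ, fun B hB hb => ?_⟩, rfl⟩
  obtain ⟨R, hR⟩ := hb.subset_closedBall 0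
  obtain ⟨n, hn⟩ := exists_nat_ge R
  have hfin : g.limitImage φ B ≠ ⊤ := ne_top_of_le_ne_top (h n)
    (measure_mono (hR.trans (Metric.closedBall_subset_closedBall hn)))
  rw [g.limitImage_apply φ hB] at hfin ⊢
  exact φ.exists_nat_of_ne_top (g.measurable_limitShift_right φ hB) hfin

/-- If all orbits are eventually constant and the limit image is finite at each point, then the
images stabilise on bounded sets. -/
theorem eventually_image_eq_limitImage {φ : CountingMeasure d}
    (hfix : ∀ x, φ.HasPoint x → g.EventuallyFixed φ x) (hfin : ∀ z, g.limitImage φ {z} ≠ ⊤)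
    {A : Set (EuclideanSpace ℝ (Fin d))} (hA : MeasurableSet A) (hb : Bornology.IsBounded A) :
    ∀ᶠ n : ℕ in atTop, g.image n φ A = g.limitImage φ A := by
  have hApts := φ.finite_setOf_hasPoint_of_ne_top (φ.measure_lt_top_of_isBounded hb).ne
  have hbasin : ∀ z, {x ∈ g.limitShift φ ⁻¹' {z} | φ.HasPoint x}.Finite := fun z =>
    φ.finite_setOf_hasPoint_of_ne_top
      (by rw [← g.limitImage_apply φ (measurableSet_singleton z)]; exact hfin z)
  -- All points whose orbit ends where that of some point of `A` ends: finitely many orbits, hence a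
  -- common stabilisation time. If `f^n(x)` or `f^∞(x)` lies in `A`, it serves as the point `y`
  -- showing `x ∈ S`, so points outside `S` contribute to neither side.
  let S : Set (EuclideanSpace ℝ (Fin d)) :=
    ⋃ y ∈ {x ∈ A | φ.HasPoint x}, {x ∈ g.limitShift φ ⁻¹' {g.limitShift φ y} | φ.HasPoint x}
  have hS : S.Finite := hApts.biUnion fun y _ => hbasin _
  have hSpt : ∀ x ∈ S, φ.HasPoint x := fun x hx => by
    obtain ⟨y, hy, hxy⟩ := mem_iUnion₂.1 hx
    exact hxy.2
  have hev : ∀ᶠ n : ℕ in atTop, ∀ x ∈ S, (g.pointShift φ)^[n] x = g.limitShift φ x :=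
    (eventually_all_finite hS).2 fun x hx => (hfix x (hSpt x hx)).eventually_eq
  filter_upwards [hev] with n hn
  rw [image, Measure.map_apply (g.measurable_iterate_pointShift_right φ n) hA,
    g.limitImage_apply φ hA]
  refine measure_congr ?_
  filter_upwards [φ.ae_hasPoint] with x hx
  refine propext ⟨fun h => ?_, fun h => ?_⟩
  · have hxS : x ∈ S := mem_iUnion₂.2 ⟨_, ⟨h, g.hasPoint_iterate_pointShift hx n⟩,
      ((hfix x hx).limitShift_iterate n).symm, hx⟩
    exact (hn x hxS ▸ h : g.limitShift φ x ∈ A)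
  · have hxS : x ∈ S := mem_iUnion₂.2 ⟨_, ⟨h, g.hasPoint_limitShift hx⟩,
      (hfix x hx).limitShift_limitShift.symm, hx⟩
    exact ((hn x hxS).symm ▸ h : (g.pointShift φ)^[n] x ∈ A)

variable (g)

/-! ### Iterates of `θ_g` on configurations with a point at the origin. -/

theorem translate_iterate_coe (φ : CountingMeasure₀ d) (n : ℕ) :
    (g.translate^[n] φ).1 = φ.1.shift ((g.pointShift φ.1)^[n] 0) := by
  induction n with
  | zero => simp
  | succ n ih =>
    have hpt := g.hasPoint_iterate_pointShift φ.2 n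
    have key : g.toFun (g.translate^[n] φ) = g.toFun ⟨φ.1.shift ((g.pointShift φ.1)^[n] 0),
      CountingMeasure.shift_hasPoint.2 (by simpa using hpt)⟩ := congrArg g.toFun (Subtype.ext ih)
    rw [Function.iterate_succ_apply', Function.iterate_succ_apply',
      g.pointShift_of_hasPoint hpt, ← CountingMeasure.shift_shift, ← key, ← ih]
    rfl

theorem measurable_translate : Measurable g.translate :=
  Measurable.subtype_mk
    (CountingMeasure.measurable_shift.comp (g.measurable'.prodMk measurable_subtype_coe))

/-- The limit of the iterates of `translate`. -/
noncomputable def limitTranslate (φ : CountingMeasure₀ d) : CountingMeasure₀ d :=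
  ⟨φ.1.shift (g.limitShift φ.1 0), CountingMeasure.shift_hasPoint.2
    (by simpa using g.hasPoint_limitShift φ.2)⟩

theorem measurable_limitTranslate : Measurable g.limitTranslate :=
  Measurable.subtype_mk (CountingMeasure.measurable_shift.comp
    ((g.measurable_limitShift.comp (measurable_subtype_coe.prodMk measurable_const)).prodMk
      measurable_subtype_coe))

variable {g}

theorem eventually_translate_iterate_eq {φ : CountingMeasure₀ d}
    (h : g.EventuallyFixed φ.1 0) : ∀ᶠ n in atTop, g.translate^[n] φ = g.limitTranslate φ := by
  filter_upwards [h.eventually_eq] with n hn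
  exact Subtype.ext (by rw [translate_iterate_coe, hn, limitTranslate])

/-- The limit is attained at some pair of consecutive times `n` and `n + 1`. -/
theorem translate_limitTranslate {φ : CountingMeasure₀ d} (h : g.EventuallyFixed φ.1 0) :
    g.translate (g.limitTranslate φ) = g.limitTranslate φ := by
  obtain ⟨n, hn, hn'⟩ := ((eventually_translate_iterate_eq h).and
    ((tendsto_add_atTop_nat 1).eventually (eventually_translate_iterate_eq h))).exists
  rw [Function.iterate_succ_apply', hn] at hn'
  exact hn'

end PointMap

/-! ### Weak convergence and densities of image measures. -/

/-- Image measures converge weakly as soon as the maps are almost surely eventually constant. -/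
theorem MeasureTheory.ProbabilityMeasure.tendsto_map_of_ae_eventually_eq {X Y : Type*}
    [MeasurableSpace X] [MeasurableSpace Y] [TopologicalSpace Y] [OpensMeasurableSpace Y]
    {μ₀ : Measure X} [IsProbabilityMeasure μ₀] {T : ℕ → X → Y} {S : X → Y}
    (hT : ∀ n, Measurable (T n)) (hS : Measurable S)
    (h : ∀ᵐ x ∂μ₀, ∀ᶠ n in atTop, T n x = S x)
    {μ : ℕ → ProbabilityMeasure Y} {ν : ProbabilityMeasure Y}
    (hμ : ∀ n, (μ n : Measure Y) = μ₀.map (T n)) (hν : (ν : Measure Y) = μ₀.map S) :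
    Tendsto μ atTop (𝓝 ν) := by
  refine ProbabilityMeasure.tendsto_iff_forall_integral_tendsto.2 fun f => ?_
  have hmap : ∀ R : X → Y, Measurable R → ∫ y, f y ∂(μ₀.map R) = ∫ x, f (R x) ∂μ₀ := fun R hR =>
    integral_map hR.aemeasurable f.continuous.measurable.aestronglyMeasurable
  simp only [hμ, hν, hmap _ (hT _), hmap _ hS]
  -- The integrands are eventually equal to their limit at almost every point, so the maps need only
  -- be measurable.
  refine tendsto_integral_of_dominated_convergence (fun _ => ‖f‖)
    (fun n => (f.continuous.measurable.comp (hT n)).aestronglyMeasurable)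
    (integrable_const _) (fun n => Eventually.of_forall fun x => f.norm_coe_le_norm _) ?_
  filter_upwards [h] with x hx
  exact tendsto_const_nhds.congr' (hx.mono fun n hn => congrArg f hn.symm)

theorem MeasureTheory.Measure.map_withDensity_comp {X Y : Type*} [MeasurableSpace X]
    [MeasurableSpace Y] (μ : Measure X) {f : X → Y} (hf : Measurable f) {r : Y → ℝ≥0∞}
    (hr : Measurable r) : (μ.withDensity (r ∘ f)).map f = (μ.map f).withDensity r := by
  ext s hs
  rw [Measure.map_apply hf hs, withDensity_apply _ (hf hs), withDensity_apply _ hs,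
    setLIntegral_map hs hr hf]
  rfl

/-! ### Palm measures of the process and of its limit image. -/

section Palm

variable {d : ℕ} {Ω : Type*} [MeasurableSpace Ω] {θ : MeasurableFlow d Ω} {P : Measure Ω}
  {Φ : Ω → CountingMeasure d}

namespace IsStationaryPointProcess

theorem measurable_shiftLimit (hΦ : IsStationaryPointProcess θ P Φ) (g : PointMap d) :
    Measurable fun ω => θ.toFun (g.limitShift (Φ ω) 0) ω :=
  θ.measurable'.comp ((g.measurable_limitShift.comp
    (hΦ.measurable.prodMk measurable_const)).prodMk measurable_id)

theorem measurable_limitShift (hΦ : IsStationaryPointProcess θ P Φ) (g : PointMap d) :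
    Measurable fun p : Ω × EuclideanSpace ℝ (Fin d) => g.limitShift (Φ p.1) p.2 :=
  g.measurable_limitShift.comp ((hΦ.measurable.comp measurable_fst).prodMk measurable_snd)

theorem measurable_restrict_map (hΦ : IsStationaryPointProcess θ P Φ)
    {B : Set (EuclideanSpace ℝ (Fin d))} (hB : MeasurableSet B) :
    Measurable fun ω => ((Φ ω).toMeasure.restrict B).map fun t => θ.toFun t ω := by
  refine Measure.measurable_of_measurable_coe _ fun F hF => ?_
  simp only [Measure.map_apply (θ.measurable_orbit _) hF,
    Measure.restrict_apply (θ.measurable_orbit _ hF)]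
  exact ProbabilityTheory.Kernel.measurable_kernel_prodMk_left (κ := hΦ.kernel)
    (((θ.measurable'.comp measurable_swap) hF).inter (measurable_snd hB))

theorem measurable_restrict_map_limitImage (hΦ : IsStationaryPointProcess θ P Φ)
    (g : PointMap d) {B : Set (EuclideanSpace ℝ (Fin d))} (hB : MeasurableSet B) :
    Measurable fun ω => ((g.limitImage (Φ ω)).restrict B).map fun t => θ.toFun t ω := by
  refine Measure.measurable_of_measurable_coe _ fun F hF => ?_
  simp only [Measure.map_apply (θ.measurable_orbit _) hF,
    Measure.restrict_apply (θ.measurable_orbit _ hF),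
    g.limitImage_apply _ ((θ.measurable_orbit _ hF).inter hB)]
  exact ProbabilityTheory.Kernel.measurable_kernel_prodMk_left (κ := hΦ.kernel)
    (((θ.measurable'.comp ((hΦ.measurable_limitShift g).prodMk measurable_fst)) hF).inter
      (hΦ.measurable_limitShift g hB))

theorem ae_eventuallyFixed (hΦ : IsStationaryPointProcess θ P Φ) {g : PointMap d}
    (hper : g.IsPeriodic 1 (P.map Φ)) :
    ∀ᵐ ω ∂P, ∀ x, (Φ ω).HasPoint x → g.EventuallyFixed (Φ ω) x := by
  filter_upwards [ae_of_ae_map hΦ.measurable.aemeasurable hper] with ω hω x hx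
  exact PointMap.eventuallyFixed_of_periodic (hω x hx)

variable [IsProbabilityMeasure P]

/-- Transfers to the Palm measure whatever holds almost surely seen from every point: the
exceptional marks then carry no Campbell mass. -/
theorem ae_palmMeasure (hΦ : IsStationaryPointProcess θ P Φ) {F : Set Ω} (hF : MeasurableSet F)
    (h : ∀ᵐ ω ∂P, ∀ x, (Φ ω).HasPoint x → θ.toFun x ω ∈ F) : ∀ᵐ ω ∂hΦ.palmMeasure, ω ∈ F := by
  change hΦ.palmMeasure Fᶜ = 0
  rw [palmMeasure_apply hΦ hF.compl, campbell_prod hΦ (measurableSet_unitCube d) hF.compl]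
  refine lintegral_eq_zero_of_ae_eq_zero ?_
  filter_upwards [h] with ω hω
  refine lintegral_eq_zero_of_ae_eq_zero ?_
  filter_upwards [(Φ ω).ae_hasPoint] with x hx
  simp [hω x hx]

theorem ae_palmMeasure_hasPoint (hΦ : IsStationaryPointProcess θ P Φ) :
    ∀ᵐ ω ∂hΦ.palmMeasure, (Φ ω).HasPoint 0 :=
  hΦ.ae_palmMeasure (F := {ω | (Φ ω).HasPoint 0})
    (hΦ.measurable CountingMeasure.measurableSet_hasPoint_zero)
    (Eventually.of_forall fun ω x hx => by
      rw [mem_ofPred_eq, hΦ.compatible, CountingMeasure.shift_hasPoint, zero_add]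
      exact hx)

theorem ae_palmMeasure_eventuallyFixed (hΦ : IsStationaryPointProcess θ P Φ) {g : PointMap d}
    (hper : g.IsPeriodic 1 (P.map Φ)) :
    ∀ᵐ ω ∂hΦ.palmMeasure, g.EventuallyFixed (Φ ω) 0 := by
  refine hΦ.ae_palmMeasure (F := {ω | g.EventuallyFixed (Φ ω) 0})
    ((hΦ.measurable.prodMk measurable_const) g.measurableSet_eventuallyFixed) ?_
  filter_upwards [hΦ.ae_eventuallyFixed hper] with ω hω x hx
  rw [hΦ.compatible, PointMap.eventuallyFixed_shift, zero_add]
  exact hω x hx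

/-- Mass transport along the limit of the point-shift. -/
theorem lintegral_limitShift
    (hΦ : IsStationaryPointProcess θ P Φ) (hfin : intensity P (fun ω => (Φ ω).toMeasure) ≠ ⊤)
    (g : PointMap d) {B : Set (EuclideanSpace ℝ (Fin d))}
    (hB : MeasurableSet B) {H : Ω → ℝ≥0∞} (hH : Measurable H) :
    ∫⁻ ω, ∫⁻ x, B.indicator 1 (g.limitShift (Φ ω) x)
        * H (θ.toFun (g.limitShift (Φ ω) x) ω) ∂(Φ ω).toMeasure ∂P
      = volume B * ∫⁻ ω, H (θ.toFun (g.limitShift (Φ ω) 0) ω) ∂hΦ.palmMeasure := by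
  -- Seen from `x`, the limit of the origin is `f^∞(x) - x`. Evaluating this function at `(x, θ_x
  -- ω)` therefore gives back the integrand at `f^∞(x)`.
  have hk : Measurable fun p : EuclideanSpace ℝ (Fin d) × Ω =>
      B.indicator (1 : EuclideanSpace ℝ (Fin d) → ℝ≥0∞) (p.1 + g.limitShift (Φ p.2) 0)
        * H (θ.toFun (g.limitShift (Φ p.2) 0) p.2) := by
    refine Measurable.mul ((measurable_one.indicator hB).comp (measurable_fst.add ?_))
      (hH.comp ((hΦ.measurable_shiftLimit g).comp measurable_snd))
    exact (hΦ.measurable_limitShift g).comp (measurable_snd.prodMk measurable_const)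
  have h := hΦ.lintegral_lintegral_flow hfin hk
  have hl : ∀ x ω, g.limitShift (Φ (θ.toFun x ω)) 0 = g.limitShift (Φ ω) x - x := fun x ω => by
    rw [hΦ.compatible, g.limitShift_shift, zero_add]
  simp only [hl, ← θ.add', sub_add_cancel, add_sub_cancel] at h
  rw [h, ← lintegral_const_mul (f := fun ω => H (θ.toFun (g.limitShift (Φ ω) 0) ω)) _
    (hH.comp (hΦ.measurable_shiftLimit g))]
  refine lintegral_congr fun ω => ?_
  have hind : Measurable fun x =>
      B.indicator (1 : EuclideanSpace ℝ (Fin d) → ℝ≥0∞) (x + g.limitShift (Φ ω) 0) :=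
    (measurable_one.indicator hB).comp (measurable_add_const _)
  -- The displacement of the typical point does not depend on the location `x`, so Lebesgue
  -- invariance removes it and leaves `volume B`.
  rw [lintegral_mul_const _ hind, lintegral_add_right_eq_self (B.indicator 1),
    lintegral_indicator_one hB]

theorem lintegral_limitImage
    (hΦ : IsStationaryPointProcess θ P Φ) (hfin : intensity P (fun ω => (Φ ω).toMeasure) ≠ ⊤)
    (g : PointMap d) {A : Set (EuclideanSpace ℝ (Fin d))}
    (hA : MeasurableSet A) : ∫⁻ ω, g.limitImage (Φ ω) A ∂P
      = volume A * intensity P fun ω => (Φ ω).toMeasure := by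
  have h := hΦ.lintegral_limitShift hfin g hA (H := 1) measurable_one
  simp only [Pi.one_apply, mul_one, lintegral_one, palmMeasure_univ] at h
  rw [← h]
  refine lintegral_congr fun ω => ?_
  rw [g.limitImage_apply _ hA, ← lintegral_indicator_one (g.measurable_limitShift_right _ hA)]
  rfl

theorem intensity_limitImage
    (hΦ : IsStationaryPointProcess θ P Φ) (hfin : intensity P (fun ω => (Φ ω).toMeasure) ≠ ⊤)
    (g : PointMap d) :
    intensity P (fun ω => g.limitImage (Φ ω)) = intensity P fun ω => (Φ ω).toMeasure := by
  have h := hΦ.lintegral_limitImage hfin g (measurableSet_unitCube d)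
  rwa [volume_unitCube, one_mul] at h

/-- A finite mean forces almost sure finiteness; this is the only source of local finiteness for the
limit image. -/
theorem ae_limitImage_closedBall_ne_top
    (hΦ : IsStationaryPointProcess θ P Φ) (hfin : intensity P (fun ω => (Φ ω).toMeasure) ≠ ⊤)
    (g : PointMap d) :
    ∀ᵐ ω ∂P, ∀ n : ℕ, g.limitImage (Φ ω) (Metric.closedBall 0 n) ≠ ⊤ := by
  refine ae_all_iff.2 fun n => ?_
  have hn : MeasurableSet (Metric.closedBall (0 : EuclideanSpace ℝ (Fin d)) n) :=
    Metric.isClosed_closedBall.measurableSet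
  refine (ae_lt_top ((g.measurable_limitImage hn).comp hΦ.measurable) ?_).mono fun ω h => h.ne
  simp only [Function.comp_apply]
  rw [hΦ.lintegral_limitImage hfin g hn]
  exact ENNReal.mul_ne_top measure_closedBall_lt_top.ne hfin

/-- The right-hand side does not involve `B`: the factorisation of the Campbell measure makes the
window cancel. -/
theorem palm_eq
    (hΦ : IsStationaryPointProcess θ P Φ) (hfin : intensity P (fun ω => (Φ ω).toMeasure) ≠ ⊤)
    {B : Set (EuclideanSpace ℝ (Fin d))} (hB : MeasurableSet B) (hB_pos : volume B ≠ 0)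
    (hB_fin : volume B ≠ ⊤) : palm θ P (fun ω => (Φ ω).toMeasure) B
    = (intensity P fun ω => (Φ ω).toMeasure)⁻¹ • hΦ.palmMeasure := by
  ext F hF
  have h := hΦ.volume_prod_palmMeasure hfin
  rw [palm_apply _ _ _ _ (hΦ.measurable_restrict_map hB).aemeasurable hF, Measure.smul_apply,
    smul_eq_mul, ENNReal.mul_inv (Or.inr hB_fin) (Or.inr hB_pos)]
  have hC : ∫⁻ ω, ∫⁻ t in B, F.indicator 1 (θ.toFun t ω) ∂(Φ ω).toMeasure ∂P
      = volume B * hΦ.palmMeasure F := by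
    have : IsFiniteMeasure hΦ.palmMeasure :=
      ⟨by rw [palmMeasure_univ]; exact lt_top_iff_ne_top.2 hfin⟩
    rw [← Measure.prod_prod, h, hΦ.campbell_prod hB hF]
    refine lintegral_congr fun ω => ?_
    rw [← lintegral_indicator hB]
    refine lintegral_congr fun x => ?_
    by_cases hx : x ∈ B <;> simp [hx]
  rw [hC, mul_assoc, ← mul_assoc _ (volume B), ENNReal.inv_mul_cancel hB_pos hB_fin, one_mul]

/-- A typical unit of mass of the limit image is a typical unit of mass of `Φ`, observed from the
end of its orbit. The two intensities agree, so the normalisations do too. -/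
theorem palm_limitImage_eq_map
    (hΦ : IsStationaryPointProcess θ P Φ) (hfin : intensity P (fun ω => (Φ ω).toMeasure) ≠ ⊤)
    {B : Set (EuclideanSpace ℝ (Fin d))} (hB : MeasurableSet B) (hB_pos : volume B ≠ 0)
    (hB_fin : volume B ≠ ⊤) (g : PointMap d) : palm θ P (fun ω => g.limitImage (Φ ω)) B
    = (palm θ P (fun ω => (Φ ω).toMeasure) B).map
        fun ω => θ.toFun (g.limitShift (Φ ω) 0) ω := by
  ext F hF
  rw [hΦ.palm_eq hfin hB hB_pos hB_fin,
    palm_apply _ _ _ _ (hΦ.measurable_restrict_map_limitImage g hB).aemeasurable hF,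
    hΦ.intensity_limitImage hfin, Measure.map_smul, Measure.smul_apply, smul_eq_mul,
    ENNReal.mul_inv (Or.inr hB_fin) (Or.inr hB_pos),
    ← lintegral_indicator_one (μ := hΦ.palmMeasure.map _) hF,
    lintegral_map (measurable_one.indicator hF) (hΦ.measurable_shiftLimit g)]
  have hC : ∫⁻ ω, ∫⁻ t in B, F.indicator 1 (θ.toFun t ω) ∂g.limitImage (Φ ω) ∂P
      = volume B * ∫⁻ ω, F.indicator 1 (θ.toFun (g.limitShift (Φ ω) 0) ω) ∂hΦ.palmMeasure := by
    refine Eq.trans (lintegral_congr fun ω => ?_) (hΦ.lintegral_limitShift hfin g hB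
      (H := F.indicator 1) (measurable_one.indicator hF))
    rw [← lintegral_indicator hB, PointMap.limitImage, lintegral_map
      (f := B.indicator fun t => F.indicator 1 (θ.toFun t ω))
      (((measurable_one.indicator hF).comp (θ.measurable_orbit ω)).indicator hB)
      (g.measurable_limitShift_right _)]
    refine lintegral_congr fun x => ?_
    by_cases hx : g.limitShift (Φ ω) x ∈ B <;> simp [hx]
  rw [hC, mul_assoc, ← mul_assoc _ (volume B), ENNReal.inv_mul_cancel hB_pos hB_fin, one_mul]

/-- Integrating against the limit image is integrating against `Φ` with weight `f^∞φ{x} / φ{x}`. By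
covariance this weight is the ratio at the origin of the configuration seen from `x`, so the
Campbell theorem carries it to the Palm measure. -/
theorem palm_limitImage_eq_withDensity
    (hΦ : IsStationaryPointProcess θ P Φ) (hfin : intensity P (fun ω => (Φ ω).toMeasure) ≠ ⊤)
    {B : Set (EuclideanSpace ℝ (Fin d))} (hB : MeasurableSet B) (hB_pos : volume B ≠ 0)
    (hB_fin : volume B ≠ ⊤) (g : PointMap d) :
    palm θ P (fun ω => g.limitImage (Φ ω)) B
      = (palm θ P (fun ω => (Φ ω).toMeasure) B).withDensity
          ((fun φ : CountingMeasure d => g.limitImage φ {0} / φ.toMeasure {0}) ∘ Φ) := by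
  ext F hF
  have hr : Measurable fun ω => g.limitImage (Φ ω) {0} / (Φ ω).toMeasure {0} :=
    ((g.measurable_limitImage (measurableSet_singleton 0)).comp hΦ.measurable).div
      ((CountingMeasure.measurable_measure (measurableSet_singleton 0)).comp hΦ.measurable)
  rw [hΦ.palm_eq hfin hB hB_pos hB_fin,
    palm_apply _ _ _ _ (hΦ.measurable_restrict_map_limitImage g hB).aemeasurable hF,
    hΦ.intensity_limitImage hfin, withDensity_smul_measure, Measure.smul_apply, smul_eq_mul,
    ENNReal.mul_inv (Or.inr hB_fin) (Or.inr hB_pos), withDensity_apply _ hF]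
  have hk : Measurable fun p : EuclideanSpace ℝ (Fin d) × Ω =>
      B.indicator (1 : EuclideanSpace ℝ (Fin d) → ℝ≥0∞) p.1 * F.indicator
        (fun ω => g.limitImage (Φ ω) {0} / (Φ ω).toMeasure {0}) p.2 :=
    ((measurable_one.indicator hB).comp measurable_fst).mul
      ((hr.indicator hF).comp measurable_snd)
  have hC : ∫⁻ ω, ∫⁻ t in B, F.indicator 1 (θ.toFun t ω) ∂g.limitImage (Φ ω) ∂P
      = volume B * ∫⁻ ω in F, g.limitImage (Φ ω) {0} / (Φ ω).toMeasure {0} ∂hΦ.palmMeasure := by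
    have h := hΦ.lintegral_lintegral_flow hfin hk
    simp only [lintegral_mul_const _ (measurable_one.indicator hB),
      lintegral_indicator_one hB] at h
    rw [lintegral_const_mul _ (hr.indicator hF), lintegral_indicator hF] at h
    rw [← h]
    refine lintegral_congr fun ω => ?_
    rw [← lintegral_indicator hB, g.lintegral_limitImage]
    refine lintegral_congr fun x => ?_
    by_cases hx : x ∈ B <;> by_cases hy : θ.toFun x ω ∈ F <;>
      simp [hx, hy, hΦ.compatible, g.limitImage_shift_singleton, CountingMeasure.shift_singleton]
  rw [hC, mul_assoc, ← mul_assoc _ (volume B), ENNReal.inv_mul_cancel hB_pos hB_fin, one_mul]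
  rfl

/-- Restricting to `N^0` through `comap` loses no mass, because the Palm measure only charges
configurations with a point at the origin. -/
theorem map_val_palmLaw
    (hΦ : IsStationaryPointProcess θ P Φ) (hfin : intensity P (fun ω => (Φ ω).toMeasure) ≠ ⊤)
    {B : Set (EuclideanSpace ℝ (Fin d))} (hB : MeasurableSet B) (hB_pos : volume B ≠ 0)
    (hB_fin : volume B ≠ ⊤) : (palmLaw θ P Φ (fun ω => (Φ ω).toMeasure) B).map Subtype.val
    = (palm θ P (fun ω => (Φ ω).toMeasure) B).map Φ := by
  refine (CountingMeasure.measurableEmbedding_val.map_comap _).trans ?_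
  refine Measure.restrict_eq_self_of_ae_mem ?_
  suffices h : ∀ᵐ φ ∂(palm θ P (fun ω => (Φ ω).toMeasure) B).map Φ, φ.HasPoint 0 from
    h.mono fun φ hφ => ⟨⟨φ, hφ⟩, rfl⟩
  rw [ae_map_iff hΦ.measurable.aemeasurable CountingMeasure.measurableSet_hasPoint_zero,
    hΦ.palm_eq hfin hB hB_pos hB_fin]
  exact Measure.ae_smul_measure hΦ.ae_palmMeasure_hasPoint _

theorem isProbabilityMeasure_palmLaw
    (hΦ : IsStationaryPointProcess θ P Φ) (hfin : intensity P (fun ω => (Φ ω).toMeasure) ≠ ⊤)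
    {B : Set (EuclideanSpace ℝ (Fin d))} (hB : MeasurableSet B) (hB_pos : volume B ≠ 0)
    (hB_fin : volume B ≠ ⊤) (hpos : intensity P (fun ω => (Φ ω).toMeasure) ≠ 0) :
    IsProbabilityMeasure (palmLaw θ P Φ (fun ω => (Φ ω).toMeasure) B) := by
  refine ⟨?_⟩
  rw [← preimage_univ (f := Subtype.val), ← Measure.map_apply measurable_subtype_coe
    MeasurableSet.univ, hΦ.map_val_palmLaw hfin hB hB_pos hB_fin,
    Measure.map_apply hΦ.measurable MeasurableSet.univ, preimage_univ,
    hΦ.palm_eq hfin hB hB_pos hB_fin, Measure.smul_apply, palmMeasure_univ, smul_eq_mul,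
    ENNReal.inv_mul_cancel hpos hfin]

theorem ae_palmLaw_eventuallyFixed
    (hΦ : IsStationaryPointProcess θ P Φ) (hfin : intensity P (fun ω => (Φ ω).toMeasure) ≠ ⊤)
    {B : Set (EuclideanSpace ℝ (Fin d))} (hB : MeasurableSet B) (hB_pos : volume B ≠ 0)
    (hB_fin : volume B ≠ ⊤) {g : PointMap d} (hper : g.IsPeriodic 1 (P.map Φ)) :
    ∀ᵐ φ ∂palmLaw θ P Φ (fun ω => (Φ ω).toMeasure) B, g.EventuallyFixed φ.1 0 := by
  have hm : MeasurableSet {φ | g.EventuallyFixed φ 0} :=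
    (measurable_id.prodMk measurable_const) g.measurableSet_eventuallyFixed
  refine ae_of_ae_map (p := fun φ => g.EventuallyFixed φ 0) measurable_subtype_coe.aemeasurable ?_
  rw [hΦ.map_val_palmLaw hfin hB hB_pos hB_fin, ae_map_iff hΦ.measurable.aemeasurable hm,
    hΦ.palm_eq hfin hB hB_pos hB_fin]
  exact Measure.ae_smul_measure (hΦ.ae_palmMeasure_eventuallyFixed hper) _

/-- By compatibility, `Φ` intertwines `ω ↦ θ_{f^∞(0)} ω` with translation of the configuration to
its limit point. -/
theorem map_limitTranslate_palmLaw
    (hΦ : IsStationaryPointProcess θ P Φ) (hfin : intensity P (fun ω => (Φ ω).toMeasure) ≠ ⊤)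
    {B : Set (EuclideanSpace ℝ (Fin d))} (hB : MeasurableSet B) (hB_pos : volume B ≠ 0)
    (hB_fin : volume B ≠ ⊤) (g : PointMap d) :
    (palmLaw θ P Φ (fun ω => (Φ ω).toMeasure) B).map g.limitTranslate
      = palmLaw θ P Φ (fun ω => g.limitImage (Φ ω)) B := by
  have hT : Measurable fun φ : CountingMeasure d => φ.shift (g.limitShift φ 0) :=
    CountingMeasure.measurable_shift.comp ((g.measurable_limitShift.comp
      (measurable_id.prodMk measurable_const)).prodMk measurable_id)
  -- Both sides become pullbacks along the inclusion, so it suffices to compare measures on the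
  -- whole space of counting measures.
  rw [← CountingMeasure.measurableEmbedding_val.comap_map
    ((palmLaw θ P Φ (fun ω => (Φ ω).toMeasure) B).map g.limitTranslate)]
  conv_rhs => rw [palmLaw, hΦ.palm_limitImage_eq_map hfin hB hB_pos hB_fin]
  congr 1
  rw [Measure.map_map measurable_subtype_coe g.measurable_limitTranslate,
    Measure.map_map hΦ.measurable (hΦ.measurable_shiftLimit g)]
  have h1 : Subtype.val ∘ g.limitTranslate
      = (fun φ : CountingMeasure d => φ.shift (g.limitShift φ 0)) ∘ Subtype.val := rfl
  have h2 : (Φ ∘ fun ω => θ.toFun (g.limitShift (Φ ω) 0) ω)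
      = (fun φ : CountingMeasure d => φ.shift (g.limitShift φ 0)) ∘ Φ :=
    funext fun ω => hΦ.compatible _ _
  rw [h1, h2, ← Measure.map_map hT measurable_subtype_coe, ← Measure.map_map hT hΦ.measurable,
    hΦ.map_val_palmLaw hfin hB hB_pos hB_fin]

theorem palmLaw_limitImage_eq_withDensity
    (hΦ : IsStationaryPointProcess θ P Φ) (hfin : intensity P (fun ω => (Φ ω).toMeasure) ≠ ⊤)
    {B : Set (EuclideanSpace ℝ (Fin d))} (hB : MeasurableSet B) (hB_pos : volume B ≠ 0)
    (hB_fin : volume B ≠ ⊤) (g : PointMap d) :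
    palmLaw θ P Φ (fun ω => g.limitImage (Φ ω)) B
      = (palmLaw θ P Φ (fun ω => (Φ ω).toMeasure) B).withDensity
          fun φ => g.limitImage φ.1 {0} / φ.1.toMeasure {0} := by
  have hr : Measurable fun φ : CountingMeasure d => g.limitImage φ {0} / φ.toMeasure {0} :=
    (g.measurable_limitImage (measurableSet_singleton 0)).div
      (CountingMeasure.measurable_measure (measurableSet_singleton 0))
  rw [← CountingMeasure.measurableEmbedding_val.comap_map
    ((palmLaw θ P Φ (fun ω => (Φ ω).toMeasure) B).withDensity _)]
  conv_lhs => rw [palmLaw, hΦ.palm_limitImage_eq_withDensity hfin hB hB_pos hB_fin,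
    Measure.map_withDensity_comp _ hΦ.measurable hr, ← hΦ.map_val_palmLaw hfin hB hB_pos hB_fin,
    ← Measure.map_withDensity_comp _ measurable_subtype_coe hr]
  rfl

end IsStationaryPointProcess

end Palm

/-! ### The main theorem. -/

theorem mainTheorem1 {d : ℕ} {Ω : Type*} [MeasurableSpace Ω] (θ : MeasurableFlow d Ω)
    (P : Measure Ω) [IsProbabilityMeasure P] (Φ : Ω → CountingMeasure d)
    (hΦ : IsStationaryPointProcess θ P Φ)
    (hpos : intensity P (fun ω => (Φ ω).toMeasure) ≠ 0)
    (hfin : intensity P (fun ω => (Φ ω).toMeasure) ≠ ⊤)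
    (g : PointMap d) (hper : g.IsPeriodic 1 (P.map Φ))
    (B : Set (EuclideanSpace ℝ (Fin d))) (hB : MeasurableSet B)
    (hB_pos : volume B ≠ 0) (hB_fin : volume B ≠ ⊤) :
    -- the limit process is almost surely a counting measure, it is almost surely the limit of
    -- the image processes, and its intensity is that of `Φ`
    ((∀ᵐ ω ∂P, (∃ ψ : CountingMeasure d, ψ.toMeasure = g.limitImage (Φ ω)) ∧
        ∀ A : Set (EuclideanSpace ℝ (Fin d)), MeasurableSet A → Bornology.IsBounded A →
          ∀ᶠ n : ℕ in atTop, g.image n (Φ ω) A = g.limitImage (Φ ω) A) ∧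
      intensity P (fun ω => g.limitImage (Φ ω)) = intensity P (fun ω => (Φ ω).toMeasure)) ∧
    -- the `g` probability of the Palm law of `Φ` exists
    ∃ Q : Measure (CountingMeasure₀ d),
      g.IsPointMapProbability (palmLaw θ P Φ (fun ω => (Φ ω).toMeasure) B) Q ∧
      Q = palmLaw θ P Φ (fun ω => g.limitImage (Φ ω)) B ∧
      Q ≪ palmLaw θ P Φ (fun ω => (Φ ω).toMeasure) B ∧
      Q.rnDeriv (palmLaw θ P Φ (fun ω => (Φ ω).toMeasure) B)
        =ᵐ[palmLaw θ P Φ (fun ω => (Φ ω).toMeasure) B]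
          (fun φ => g.limitImage φ.1 {0} / φ.1.toMeasure {0}) ∧
      Q.map g.translate = Q := by
  refine ⟨⟨?_, hΦ.intensity_limitImage hfin g⟩,
    (palmLaw θ P Φ (fun ω => (Φ ω).toMeasure) B).map g.limitTranslate, ?_,
    hΦ.map_limitTranslate_palmLaw hfin hB hB_pos hB_fin g, ?_, ?_, ?_⟩
  · filter_upwards [hΦ.ae_eventuallyFixed hper, hΦ.ae_limitImage_closedBall_ne_top hfin g]
      with ω hfix hball
    refine ⟨PointMap.exists_toMeasure_eq_limitImage hball, fun A hA hb =>
      PointMap.eventually_image_eq_limitImage hfix (fun z => ?_) hA hb⟩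
    -- Finite atoms, hence finite basins of `f^∞`, follow from finiteness on a ball containing `z`.
    obtain ⟨n, hn⟩ := exists_nat_ge ‖z‖
    exact ne_top_of_le_ne_top (hball n) (measure_mono (by simpa using hn))
  · have := hΦ.isProbabilityMeasure_palmLaw hfin hB hB_pos hB_fin hpos
    have hT : ∀ n, Measurable g.translate^[n] := fun n => g.measurable_translate.iterate n
    have hL := g.measurable_limitTranslate
    refine ⟨fun n => ⟨_, Measure.isProbabilityMeasure_map (hT n).aemeasurable⟩,
      ⟨_, Measure.isProbabilityMeasure_map hL.aemeasurable⟩, fun n => rfl, rfl, ?_⟩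
    refine ProbabilityMeasure.tendsto_map_of_ae_eventually_eq hT hL ?_ (fun n => rfl) rfl
    filter_upwards [hΦ.ae_palmLaw_eventuallyFixed hfin hB hB_pos hB_fin hper] with φ hφ
    exact PointMap.eventually_translate_iterate_eq hφ
  · rw [hΦ.map_limitTranslate_palmLaw hfin hB hB_pos hB_fin,
      hΦ.palmLaw_limitImage_eq_withDensity hfin hB hB_pos hB_fin]
    exact withDensity_absolutelyContinuous _ _
  · have := hΦ.isProbabilityMeasure_palmLaw hfin hB hB_pos hB_fin hpos
    rw [hΦ.map_limitTranslate_palmLaw hfin hB hB_pos hB_fin,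
      hΦ.palmLaw_limitImage_eq_withDensity hfin hB hB_pos hB_fin]
    refine Measure.rnDeriv_withDensity _ ?_
    exact ((g.measurable_limitImage (measurableSet_singleton 0)).div
      (CountingMeasure.measurable_measure (measurableSet_singleton 0))).comp measurable_subtype_coe
  · rw [Measure.map_map g.measurable_translate g.measurable_limitTranslate]
    refine Measure.map_congr ?_
    filter_upwards [hΦ.ae_palmLaw_eventuallyFixed hfin hB hB_pos hB_fin hper] with φ hφ
    exact PointMap.translate_limitTranslate hφ
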